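/- Let $n\ge 1$, $\frac1n<\alpha\le 1$ and $0<T<\infty$. Let $\Sigma$ be a compact connected smooth $n$-manifold and let $X:\Sigma\times[0,T)\to\mathbb{R}^{n+1}$ be a smooth solution of the $\alpha$-Gauss curvature flow $$\frac{\partial X}{\partial t}(x,t)=-K^\alpha(x,t)\,\nu(x,t)$$ such that every $X(\cdot,t)$ is a smooth embedding. Here $\nu$ is the (continuous) outward unit normal of $\Sigma_t=X(\Sigma,t)$ and, in local coordinates, $g_{ij}=\langle\partial_iX,\partial_jX\rangle$, $h_{ij}=-\langle\partial_i\partial_jX,\nu\rangle$, $K=\det(g^{ik}h_{kj})$. Assume that the initial hypersurface $\Sigma_0$ is strictly convex, i.e. $(h_{ij})$ is positive definite at $t=0$. Then $\Sigma_t$ is strictly convex for every $t\in(0,T)$, so that the sum of the principal radii $\mathcal{H}=(h^{-1})^{ij}g_{ij}$ is defined, and there is a constant $C>0$, independent of $t$, such that for all $t\in(0,T)$ $$\sup_{x\in\Sigma}\mathcal{H}(x,t)\;\le\;\max\Big(\sup_{x\in\Sigma}\Big(\frac{n\alpha-1}{\alpha}K^{-1/n}(x,t)\Big),\ \sup_{x\in\Sigma}\mathcal{H}(x,0)\Big)\;\le\;C,$$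 where the first supremum is finite. -/

import Mathlib

open Set Filter Topology
open scoped Manifold ContDiff

noncomputable section

namespace GaussCurvatureFlow

variable {n : ℕ} {M : Type*} [TopologicalSpace M] [ChartedSpace (EuclideanSpace ℝ (Fin n)) M]

/-- The map `f : M → ℝⁿ⁺¹` read in the local coordinates of `M` around `x`. -/
def localParam (f : M → EuclideanSpace ℝ (Fin (n + 1))) (x : M) :
    EuclideanSpace ℝ (Fin n) → EuclideanSpace ℝ (Fin (n + 1)) :=
  f ∘ (extChartAt 𝓘(ℝ, EuclideanSpace ℝ (Fin n)) x).symm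

/-- The coordinate derivative `∂F / ∂xⁱ` at the coordinate point `u`. -/
def partialDeriv (i : Fin n)
    (F : EuclideanSpace ℝ (Fin n) → EuclideanSpace ℝ (Fin (n + 1)))
    (u : EuclideanSpace ℝ (Fin n)) : EuclideanSpace ℝ (Fin (n + 1)) :=
  fderiv ℝ F u (EuclideanSpace.single i 1)

/-- The induced metric `g_ij = ⟨∂f/∂xⁱ, ∂f/∂xʲ⟩` at `x`, in the local coordinates around `x`. -/
def metric (f : M → EuclideanSpace ℝ (Fin (n + 1))) (x : M) : Matrix (Fin n) (Fin n) ℝ :=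
  Matrix.of fun i j =>
    inner ℝ
      (partialDeriv i (localParam f x) (extChartAt 𝓘(ℝ, EuclideanSpace ℝ (Fin n)) x x))
      (partialDeriv j (localParam f x) (extChartAt 𝓘(ℝ, EuclideanSpace ℝ (Fin n)) x x))

/-- The second fundamental form `h_ij = -⟨∂²f/∂xⁱ∂xʲ, ν⟩` at `x` with respect to the normal field
`ν`, in the local coordinates around `x`. -/
def secondForm (f ν : M → EuclideanSpace ℝ (Fin (n + 1))) (x : M) : Matrix (Fin n) (Fin n) ℝ :=
  Matrix.of fun i j =>
    -inner ℝ
      (partialDeriv i (partialDeriv j (localParam f x))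
        (extChartAt 𝓘(ℝ, EuclideanSpace ℝ (Fin n)) x x))
      (ν x)

/-- The Weingarten map `h^i_j = g^{ik} h_{kj}`. -/
def weingarten (f ν : M → EuclideanSpace ℝ (Fin (n + 1))) (x : M) : Matrix (Fin n) (Fin n) ℝ :=
  (metric f x)⁻¹ * secondForm f ν x

/-- The Gauss curvature `K = det (h^i_j)`, which does not depend on the coordinates. -/
def gaussCurvature (f ν : M → EuclideanSpace ℝ (Fin (n + 1))) (x : M) : ℝ :=
  (weingarten f ν x).det

/-- The sum of the principal radii `𝓗 = (h⁻¹)^{ij} g_{ij}`, which does not depend on the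
coordinates; it is meaningful where the second fundamental form is invertible. -/
def sumRadii (f ν : M → EuclideanSpace ℝ (Fin (n + 1))) (x : M) : ℝ :=
  ∑ i, ∑ j, (secondForm f ν x)⁻¹ i j * metric f x i j

/-- Strict convexity: the second fundamental form with respect to the outward unit normal `ν` is
positive definite everywhere, that is, all principal curvatures are positive. -/
def IsStrictlyConvex (f ν : M → EuclideanSpace ℝ (Fin (n + 1))) : Prop :=
  ∀ x, (secondForm f ν x).PosDef

/-- `v` points out of the closed hypersurface `f(M)` at `f x`: close to `f x`, the ray from `f x` in
the direction `v` runs in the unbounded component of the complement of `f(M)`. -/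
def PointsOutward (f : M → EuclideanSpace ℝ (Fin (n + 1))) (x : M)
    (v : EuclideanSpace ℝ (Fin (n + 1))) : Prop :=
  ∀ᶠ s : ℝ in 𝓝[>] 0,
    f x + s • v ∈ (range f)ᶜ ∧
      ¬ Bornology.IsBounded (connectedComponentIn (range f)ᶜ (f x + s • v))

/-- `ν` is the outward unit normal of the hypersurface `f(M)`. -/
structure IsOutwardUnitNormal (f ν : M → EuclideanSpace ℝ (Fin (n + 1))) : Prop where
  norm_eq_one : ∀ x, ‖ν x‖ = 1
  normal : ∀ (x : M) (v : TangentSpace 𝓘(ℝ, EuclideanSpace ℝ (Fin n)) x),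
    inner ℝ (ν x) (mfderiv 𝓘(ℝ, EuclideanSpace ℝ (Fin n))
      𝓘(ℝ, EuclideanSpace ℝ (Fin (n + 1))) f x v : EuclideanSpace ℝ (Fin (n + 1))) = 0
  outward : ∀ x, PointsOutward f x (ν x)

/-- `X : M × [0, T) → ℝⁿ⁺¹` is a smooth solution of the `α`-Gauss curvature flow
`∂X/∂t = -K^α ν` by embedded hypersurfaces `Σ_t = X(M, t)` with outward unit normal `ν(·, t)`.
Smoothness is up to and including the initial time; no convexity is required. -/
structure IsSmoothFlow (α T : ℝ) (X ν : M → ℝ → EuclideanSpace ℝ (Fin (n + 1))) : Prop where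
  smooth : ContMDiffOn (𝓘(ℝ, EuclideanSpace ℝ (Fin n)).prod 𝓘(ℝ, ℝ))
    𝓘(ℝ, EuclideanSpace ℝ (Fin (n + 1))) ∞ (fun p : M × ℝ => X p.1 p.2) (univ ×ˢ Ico 0 T)
  embedding : ∀ t ∈ Ico 0 T, IsEmbedding (fun x => X x t)
  immersion : ∀ t ∈ Ico 0 T, ∀ x, Function.Injective
    (mfderiv 𝓘(ℝ, EuclideanSpace ℝ (Fin n)) 𝓘(ℝ, EuclideanSpace ℝ (Fin (n + 1)))
      (fun y => X y t) x)
  continuous_normal : ContinuousOn (fun p : M × ℝ => ν p.1 p.2) (univ ×ˢ Ico 0 T)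
  outward_normal : ∀ t ∈ Ico 0 T, IsOutwardUnitNormal (fun x => X x t) (fun x => ν x t)
  evolution : ∀ t ∈ Ico 0 T, ∀ x, HasDerivWithinAt (fun s => X x s)
    (-((gaussCurvature (fun y => X y t) (fun y => ν y t) x) ^ α) • ν x t) (Ico 0 T) t

end GaussCurvatureFlow

end

/-!
The supremum of the sum of the principal radii `𝓗` never increases along the flow, and strict
convexity is preserved because `𝓗` stays bounded. The first term of the maximum is never needed for
the upper bound on `sup 𝓗(·, t)`, and it is itself bounded by `sup 𝓗(·, 0)`: by the inequality of
arithmetic and geometric means for the radii, `n K ^ (-1 / n) ≤ 𝓗`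
(`card_mul_curvature_rpow_le_sumRadii`).

*Maximum principle.* Suppose that `𝓗` attains its maximum over `M × [0, t₀]` at `(x₀, t₀)` with
`0 < t₀`. In an orthonormal basis whose last vector is `ν(x₀, t₀)`, write the normal as a positive
multiple of `(y, 1)`. Since the second fundamental form is positive definite, `(y, t)` are smooth
space-time coordinates near `(x₀, t₀)` (`exists_gaussCoordinates`). In these, the Legendre transform
`u = ⟨X, (y, 1)⟩` carries the whole geometry: with `A = D²u` and `w = 1 + |y|²`,
`g = A (1 + y yᵀ) A`, `h = w ^ (-1 / 2) A`, `𝓗 = √w (tr A + ⟨y, A y⟩)`,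
`K⁻¹ = w ^ ((n + 2) / 2) det A`, and the flow becomes the scalar equation
`∂ₜu = -w ^ ((1 - α (n + 2)) / 2) (det A) ^ (-α)`.
At `y = 0` the maximum gives `∂ₜ Δu ≥ 0` and `D² Δu ≤ -(Δu) 1 - 2 A`. The function
`A ↦ (det A) ^ (-α)` is convex, so replacing it by its tangent at `A₀ = A(0, t₀)` bounds `Δ ∂ₜu`
from above by an expression linear in `D² Δu`. Together with `tr A₀⁻¹ tr A₀ ≥ n²` this yields
`0 ≤ ∂ₜ Δu = Δ ∂ₜu ≤ -n (det A₀) ^ (-α)`, which is absurd (`not_isMax_sumRadii_of_legendre`). The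
Laplacians are compared through second difference quotients, so that only the tangent inequality,
not the second derivative of the determinant, is needed.

*Convexity.* By compactness there would be a first time at which `h` fails to be positive definite.
Before it `𝓗 ≤ m = sup 𝓗(·, 0)`, hence `det g ≤ (m / n) ^ n det h`. In the limit `h` is positive
semidefinite with nonzero determinant, thus positive definite (`isStrictlyConvex_of_forall_lt`).

The quantities `𝓗` and `K` are defined in the preferred chart at each point; they are compared in a
fixed chart, and in the coordinates `y`, through the tensor law under changes of parameters
(`paramMetric_comp`, `paramSecondForm_comp`).
-/

namespace GaussCurvatureFlow

/-! ### Positive definite matrices -/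

section LinearAlgebra

variable {ι : Type*} [Fintype ι] [DecidableEq ι]

open scoped MatrixOrder in
theorem exists_isUnit_conjTranspose_mul_self {A : Matrix ι ι ℝ} (hA : A.PosDef) :
    ∃ C : Matrix ι ι ℝ, IsUnit C ∧ A = C.conjTranspose * C :=
  CStarAlgebra.isStrictlyPositive_iff_eq_star_mul_self.mp hA.isStrictlyPositive

/-- The product of two positive definite matrices has the trace and the determinant of a positive
definite matrix. -/
theorem exists_posDef_trace_det {A B : Matrix ι ι ℝ} (hA : A.PosDef) (hB : B.PosDef) :
    ∃ P : Matrix ι ι ℝ, P.PosDef ∧ P.trace = (A * B).trace ∧ P.det = A.det * B.det := by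
  obtain ⟨C, hC, rfl⟩ := exists_isUnit_conjTranspose_mul_self hA
  refine ⟨C * B * C.conjTranspose, ?_, ?_, ?_⟩
  · refine hB.mul_mul_conjTranspose_same ?_
    exact Matrix.vecMul_injective_iff_isUnit.2 hC
  · rw [Matrix.trace_mul_comm, Matrix.mul_assoc]
  · simp only [Matrix.det_mul]; ring

theorem log_det_le_trace_sub_card {P : Matrix ι ι ℝ} (hP : P.PosDef) :
    Real.log P.det ≤ P.trace - Fintype.card ι := by
  rw [hP.isHermitian.det_eq_prod_eigenvalues, hP.isHermitian.trace_eq_sum_eigenvalues]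
  simp only [RCLike.ofReal_real_eq_id, id]
  rw [Real.log_prod (fun i _ => (hP.eigenvalues_pos i).ne')]
  calc _ ≤ ∑ i, (hP.isHermitian.eigenvalues i - 1) :=
        Finset.sum_le_sum fun i _ => Real.log_le_sub_one_of_pos (hP.eigenvalues_pos i)
    _ = _ := by simp

/-- The inequality of arithmetic and geometric means for the eigenvalues of a product of two
positive definite matrices. -/
theorem card_mul_det_rpow_le_trace [Nonempty ι] {A B : Matrix ι ι ℝ} (hA : A.PosDef)
    (hB : B.PosDef) :
    Fintype.card ι * (A.det * B.det) ^ (1 / (Fintype.card ι : ℝ)) ≤ (A * B).trace := by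
  obtain ⟨P, hP, htr, hdet⟩ := exists_posDef_trace_det hA hB
  rw [← htr, ← hdet]
  have hn : (0 : ℝ) < Fintype.card ι := by exact_mod_cast Fintype.card_pos
  have hd := hP.det_pos
  set r := P.det ^ (1 / (Fintype.card ι : ℝ)) with hr
  have hr0 : 0 < r := Real.rpow_pos_of_pos hd _
  -- rescaling `P` to determinant one turns the logarithmic inequality into the claim
  have h := log_det_le_trace_sub_card (hP.smul (inv_pos.2 hr0))
  have hdet1 : (r⁻¹ • P).det = 1 := by
    rw [Matrix.det_smul, hr, inv_pow, ← Real.rpow_natCast, ← Real.rpow_mul hd.le,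
      one_div_mul_cancel hn.ne', Real.rpow_one, inv_mul_cancel₀ hd.ne']
  rw [hdet1, Real.log_one, Matrix.trace_smul, smul_eq_mul, inv_mul_eq_div, sub_nonneg,
    le_div_iff₀ hr0] at h
  exact h

theorem card_sq_le_trace_inv_mul_trace [Nonempty ι] {A : Matrix ι ι ℝ} (hA : A.PosDef) :
    (Fintype.card ι : ℝ) ^ 2 ≤ A⁻¹.trace * A.trace := by
  have h1 := card_mul_det_rpow_le_trace hA Matrix.PosDef.one
  have h2 := card_mul_det_rpow_le_trace hA.inv Matrix.PosDef.one
  simp only [Matrix.det_one, mul_one] at h1 h2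
  have hd := hA.det_pos
  have hd' := hA.inv.det_pos
  have hprod : A⁻¹.det ^ (1 / (Fintype.card ι : ℝ)) * A.det ^ (1 / (Fintype.card ι : ℝ)) = 1 := by
    rw [← Real.mul_rpow hd'.le hd.le, ← Matrix.det_mul,
      Matrix.nonsing_inv_mul _ hd.ne'.isUnit, Matrix.det_one, Real.one_rpow]
  calc (Fintype.card ι : ℝ) ^ 2
      = (Fintype.card ι * A⁻¹.det ^ (1 / (Fintype.card ι : ℝ))) *
          (Fintype.card ι * A.det ^ (1 / (Fintype.card ι : ℝ))) := by
        rw [mul_mul_mul_comm, hprod, mul_one, sq]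
    _ ≤ _ := mul_le_mul h2 h1 (by positivity) (le_trans (by positivity) h2)

/-- The convex function `A ↦ (det A) ^ (-α)` lies above its tangent at `A₀`. -/
theorem tangent_le_det_rpow_neg {A₀ A : Matrix ι ι ℝ} (hA₀ : A₀.PosDef) (hA : A.PosDef)
    {α : ℝ} (hα : 0 ≤ α) :
    A₀.det ^ (-α) * (1 + Fintype.card ι * α - α * (A₀⁻¹ * A).trace) ≤ A.det ^ (-α) := by
  obtain ⟨P, hP, htr, hdet⟩ := exists_posDef_trace_det hA₀.inv hA
  have hd₀ := hA₀.det_pos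
  have hdP := hP.det_pos
  have hfac : A.det = A₀.det * P.det := by
    rw [hdet, ← mul_assoc, ← Matrix.det_mul, Matrix.mul_nonsing_inv _ hd₀.ne'.isUnit,
      Matrix.det_one, one_mul]
  rw [hfac, Real.mul_rpow hd₀.le hdP.le, ← htr]
  refine mul_le_mul_of_nonneg_left ?_ (Real.rpow_nonneg hd₀.le _)
  rw [Real.rpow_def_of_pos hdP]
  have h1 := Real.add_one_le_exp (Real.log P.det * -α)
  have h2 := mul_le_mul_of_nonneg_left (log_det_le_trace_sub_card hP) hα
  linarith

end LinearAlgebra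

/-- Positive definiteness is an open condition on symmetric matrices. -/
theorem eventually_posDef {ι : Type*} [Fintype ι] {Z : Type*} [TopologicalSpace Z]
    {A : Z → Matrix ι ι ℝ} {s : Set Z}
    {z : Z} (hc : ContinuousOn A s) (hz : z ∈ s) (hsymm : ∀ y ∈ s, (A y).IsHermitian)
    (hA : (A z).PosDef) : ∀ᶠ y in 𝓝[s] z, (A y).PosDef := by
  set S : Set (EuclideanSpace ℝ ι) := Metric.sphere 0 1
  have hS : IsCompact S := isCompact_sphere 0 1
  have hq : ContinuousOn (fun p : Z × EuclideanSpace ℝ ι =>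
      p.2.ofLp ⬝ᵥ ((A p.1).mulVec p.2.ofLp)) (s ×ˢ univ) := by
    have h1 : ContinuousOn (fun p : Z × EuclideanSpace ℝ ι => A p.1) (s ×ˢ univ) :=
      hc.comp continuousOn_fst fun p hp => hp.1
    simp only [dotProduct, Matrix.mulVec]
    refine continuousOn_finsetSum _ fun i _ => ContinuousOn.mul (by fun_prop)
      (continuousOn_finsetSum _ fun j _ => ContinuousOn.mul ?_ (by fun_prop))
    exact (continuous_apply_apply i j).comp_continuousOn h1
  have hev : ∀ᶠ y in 𝓝 z, ∀ v ∈ S, y ∈ s → 0 < v.ofLp ⬝ᵥ ((A y).mulVec v.ofLp) := by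
    refine hS.eventually_forall_of_forall_eventually fun v hv => ?_
    have hv0 : v.ofLp ≠ 0 := by
      intro h
      have : v = 0 := by ext i; simp [h]
      simp [S, this] at hv
    have hpos : 0 < v.ofLp ⬝ᵥ ((A z).mulVec v.ofLp) := by
      simpa using hA.dotProduct_mulVec_pos hv0
    have := (hq (z, v) ⟨hz, mem_univ _⟩).eventually (lt_mem_nhds hpos)
    filter_upwards [eventually_nhdsWithin_iff.1 this] with p hp hps using hp ⟨hps, mem_univ _⟩
  filter_upwards [nhdsWithin_le_nhds hev, self_mem_nhdsWithin] with y hy hys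
  refine Matrix.PosDef.of_dotProduct_mulVec_pos (hsymm y hys) fun x hx => ?_
  set v : EuclideanSpace ℝ ι := WithLp.toLp 2 x
  have hv : 0 < ‖v‖ := norm_pos_iff.2 fun h => hx (by simpa [v] using h)
  have := hy (‖v‖⁻¹ • v) (by simp [S, norm_smul, hv.ne']) hys
  simp only [WithLp.ofLp_smul, Matrix.mulVec_smul, smul_dotProduct, dotProduct_smul,
    smul_eq_mul] at this
  have h2 : 0 < ‖v‖⁻¹ := inv_pos.2 hv
  simpa [v] using (mul_pos_iff_of_pos_left h2).1 ((mul_pos_iff_of_pos_left h2).1 this)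

/-! ### Directional derivatives and second differences -/

section DirDeriv

variable {V F : Type*} [NormedAddCommGroup V] [NormedSpace ℝ V] [NormedAddCommGroup F]
  [NormedSpace ℝ F] {U : Set V} {z : V}

/-- The derivative of `f` in the constant direction `v`, as a function of the base point, so that
it can be iterated. -/
noncomputable def dirDeriv (v : V) (f : V → F) (z : V) : F := fderiv ℝ f z v

theorem contDiffOn_dirDeriv (hU : IsOpen U) {f : V → F} (hf : ContDiffOn ℝ ∞ f U) (v : V) :
    ContDiffOn ℝ ∞ (dirDeriv v f) U :=
  (hf.fderiv_of_isOpen hU (by simp)).clm_apply contDiffOn_const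

theorem differentiableAt_of_contDiffOn (hU : IsOpen U) {f : V → F} (hf : ContDiffOn ℝ ∞ f U)
    (hz : z ∈ U) : DifferentiableAt ℝ f z :=
  (hf.contDiffAt (hU.mem_nhds hz)).differentiableAt (by simp)

theorem dirDeriv_congr (hU : IsOpen U) {f g : V → F} (h : EqOn f g U) (v : V) :
    EqOn (dirDeriv v f) (dirDeriv v g) U := fun z hz => by
  rw [dirDeriv, dirDeriv, (h.eventuallyEq_of_mem (hU.mem_nhds hz)).fderiv_eq]

theorem dirDeriv_comm (hU : IsOpen U) {f : V → F} (hf : ContDiffOn ℝ ∞ f U) (v w : V) :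
    EqOn (dirDeriv v (dirDeriv w f)) (dirDeriv w (dirDeriv v f)) U := fun z hz => by
  have hd : DifferentiableAt ℝ (fderiv ℝ f) z :=
    differentiableAt_of_contDiffOn hU (hf.fderiv_of_isOpen hU (by simp)) hz
  have key : ∀ v w : V, dirDeriv v (dirDeriv w f) z = fderiv ℝ (fderiv ℝ f) z v w := fun v w => by
    unfold dirDeriv
    rw [fderiv_clm_apply hd (differentiableAt_const w)]
    simp
  rw [key, key]
  exact ((hf.contDiffAt (hU.mem_nhds hz)).isSymmSndFDerivAt
    (by simp only [minSmoothness_of_isRCLikeNormedField]; exact ENat.LEInfty.out)).eq v w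

theorem dirDeriv_sum_smul (hU : IsOpen U) {κ : Type*} (s : Finset κ) (c : κ → ℝ)
    {f : κ → V → F} (hf : ∀ k ∈ s, ContDiffOn ℝ ∞ (f k) U) (v : V) :
    EqOn (dirDeriv v fun z => ∑ k ∈ s, c k • f k z) (fun z => ∑ k ∈ s, c k • dirDeriv v (f k) z)
      U := fun z hz => by
  have hd : ∀ k ∈ s, DifferentiableAt ℝ (f k) z := fun k hk =>
    differentiableAt_of_contDiffOn hU (hf k hk) hz
  unfold dirDeriv
  rw [fderiv_fun_sum (A := fun k z => c k • f k z) fun k hk => (hd k hk).const_smul (c k)]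
  simp only [sum_apply]
  refine Finset.sum_congr rfl fun k hk => ?_
  rw [fderiv_fun_const_smul (hd k hk)]
  rfl

theorem hasDerivAt_line (hU : IsOpen U) {f : V → F} (hf : ContDiffOn ℝ ∞ f U) (v : V) {s : ℝ}
    (hs : z + s • v ∈ U) :
    HasDerivAt (fun s : ℝ => f (z + s • v)) (dirDeriv v f (z + s • v)) s := by
  have h1 : HasDerivAt (fun s : ℝ => z + s • v) v s := by
    simpa using ((hasDerivAt_id s).smul_const v).const_add z
  exact (differentiableAt_of_contDiffOn hU hf hs).hasFDerivAt.comp_hasDerivAt s h1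

theorem tendsto_second_difference (hU : IsOpen U) {f : V → ℝ} (hf : ContDiffOn ℝ ∞ f U) (v : V)
    (hz : z ∈ U) :
    Tendsto (fun s : ℝ => (f (z + s • v) + f (z + (-s) • v) - 2 * f z) / s ^ 2) (𝓝[>] 0)
      (𝓝 (dirDeriv v (dirDeriv v f) z)) := by
  have hcont : Continuous fun s : ℝ => z + s • v := by fun_prop
  have hmem : ∀ᶠ s : ℝ in 𝓝 0, z + s • v ∈ U :=
    hcont.continuousAt.eventually (by simpa using hU.mem_nhds hz)
  have hmem' : ∀ᶠ s : ℝ in 𝓝 0, z + (-s) • v ∈ U :=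
    (show Continuous fun s : ℝ => z + (-s) • v by fun_prop).continuousAt.eventually
      (by simpa using hU.mem_nhds hz)
  set g := dirDeriv v f with hg
  have hg0 : HasDerivAt (fun s : ℝ => g (z + s • v)) (dirDeriv v g z) 0 := by
    simpa using hasDerivAt_line hU (contDiffOn_dirDeriv hU hf v) v (z := z) (s := 0)
      (by simpa using hz)
  refine HasDerivAt.lhopital_zero_nhdsGT
    (f' := fun s => g (z + s • v) - g (z + (-s) • v)) (g' := fun s => 2 * s) ?_ ?_ ?_ ?_ ?_ ?_
  · filter_upwards [nhdsWithin_le_nhds hmem, nhdsWithin_le_nhds hmem'] with s h1 h2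
    have h3 := hasDerivAt_line hU hf v h1
    have h4 := (hasDerivAt_line hU hf v h2).scomp s (hasDerivAt_neg s)
    simpa [sub_eq_add_neg] using (h3.add h4).sub_const (2 * f z)
  · filter_upwards with s
    simpa using hasDerivAt_pow 2 s
  · filter_upwards [self_mem_nhdsWithin] with s hs
    have : (0 : ℝ) < s := hs
    positivity
  · have h1 := (hasDerivAt_line hU hf v (z := z) (s := 0) (by simpa using hz)).continuousAt.tendsto
    have h2 : Tendsto (fun s : ℝ => f (z + (-s) • v)) (𝓝 0) (𝓝 (f z)) := by
      have := h1.comp (show Tendsto (fun s : ℝ => -s) (𝓝 0) (𝓝 0) by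
        simpa using (continuous_neg.tendsto (0 : ℝ)))
      simpa [Function.comp_def] using this
    have h3 := (h1.add h2).sub_const (2 * f z)
    simp only [zero_smul, add_zero] at h3
    rw [← two_mul, sub_self] at h3
    exact h3.mono_left nhdsWithin_le_nhds
  · have : Tendsto (fun s : ℝ => s ^ 2) (𝓝 0) (𝓝 0) := by
      simpa using (continuous_pow 2).tendsto (0 : ℝ)
    exact this.mono_left nhdsWithin_le_nhds
  · have h1 := (hasDerivAt_iff_tendsto_slope.1 hg0).mono_left
      (nhdsWithin_mono 0 (fun s (hs : (0 : ℝ) < s) => hs.ne') : 𝓝[>] (0 : ℝ) ≤ 𝓝[≠] 0)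
    have hneg : HasDerivAt (fun s : ℝ => g (z + (-s) • v)) (-dirDeriv v g z) 0 := by
      have := HasDerivAt.scomp (0 : ℝ) (h := fun s : ℝ => -s)
        (g₁ := fun s : ℝ => g (z + s • v)) (by simpa using hg0) (hasDerivAt_neg 0)
      simpa [Function.comp_def] using this
    have h2 := (hasDerivAt_iff_tendsto_slope.1 hneg).mono_left
      (nhdsWithin_mono 0 (fun s (hs : (0 : ℝ) < s) => hs.ne') : 𝓝[>] (0 : ℝ) ≤ 𝓝[≠] 0)
    have h3 := (h1.sub h2).div_const 2
    rw [sub_neg_eq_add, ← two_mul, mul_div_cancel_left₀ _ two_ne_zero] at h3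
    refine h3.congr' ?_
    filter_upwards [self_mem_nhdsWithin] with s hs
    have : s ≠ 0 := (show (0 : ℝ) < s from hs).ne'
    simp only [slope_def_field, neg_zero, zero_smul, add_zero, sub_zero]
    field_simp
    ring

/-- The second differences of `s ↦ (1 + c s²) ^ β` at zero converge to its second derivative. -/
theorem tendsto_rpow_sub_one_div_sq (c β : ℝ) :
    Tendsto (fun s : ℝ => ((1 + c * s ^ 2) ^ β - 1) / s ^ 2) (𝓝[>] 0) (𝓝 (c * β)) := by
  have h : HasDerivAt (fun x : ℝ => (1 + c * x) ^ β) (c * β) 0 := by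
    have := (((hasDerivAt_id (0 : ℝ)).const_mul c).const_add 1).rpow_const (p := β)
      (Or.inl (by simp))
    simpa using this
  have hsq : Tendsto (fun s : ℝ => s ^ 2) (𝓝[>] 0) (𝓝[≠] 0) := by
    refine tendsto_nhdsWithin_iff.2 ⟨?_, ?_⟩
    · have : Tendsto (fun s : ℝ => s ^ 2) (𝓝 0) (𝓝 0) := by
        simpa using (continuous_pow 2).tendsto (0 : ℝ)
      exact this.mono_left nhdsWithin_le_nhds
    · filter_upwards [self_mem_nhdsWithin] with s hs
      exact pow_ne_zero 2 (show (0 : ℝ) < s from hs).ne'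
  refine ((hasDerivAt_iff_tendsto_slope.1 h).comp hsq).congr fun s => ?_
  simp [slope_def_field]

end DirDeriv

/-! ### The maximum principle for the Legendre transform -/

section MaximumPrinciple

variable {n : ℕ}

/-- The `k`-th spatial direction of space-time `ℝⁿ × ℝ`. -/
noncomputable def spaceDir (k : Fin n) : EuclideanSpace ℝ (Fin n) × ℝ :=
  (EuclideanSpace.single k 1, 0)

/-- The matrix of second spatial derivatives of a function on space-time. -/
noncomputable def spaceHessian (u : EuclideanSpace ℝ (Fin n) × ℝ → ℝ)
    (z : EuclideanSpace ℝ (Fin n) × ℝ) : Matrix (Fin n) (Fin n) ℝ :=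
  Matrix.of fun i j => dirDeriv (spaceDir i) (dirDeriv (spaceDir j) u) z

variable {Ω : Set (EuclideanSpace ℝ (Fin n) × ℝ)} {t₀ : ℝ}
  {u : EuclideanSpace ℝ (Fin n) × ℝ → ℝ}

theorem contDiffOn_spaceHessian_trace (hΩ : IsOpen Ω) (hu : ContDiffOn ℝ ∞ u Ω) :
    ContDiffOn ℝ ∞ (fun z => (spaceHessian u z).trace) Ω := by
  simp only [Matrix.trace, Matrix.diag, spaceHessian, Matrix.of_apply]
  exact ContDiffOn.sum fun k _ => contDiffOn_dirDeriv hΩ (contDiffOn_dirDeriv hΩ hu _) _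

theorem mk_zero_eq_sum (v : EuclideanSpace ℝ (Fin n)) :
    ((v, 0) : EuclideanSpace ℝ (Fin n) × ℝ) = ∑ k, v k • spaceDir k := by
  refine Prod.ext ?_ ?_
  · ext i
    simp [spaceDir, Prod.fst_sum, Finset.sum_apply, Pi.single_apply]
  · simp [spaceDir, Prod.snd_sum]

theorem dirDeriv_mk_zero {F : Type*} [NormedAddCommGroup F] [NormedSpace ℝ F]
    (f : EuclideanSpace ℝ (Fin n) × ℝ → F) (v : EuclideanSpace ℝ (Fin n)) :
    dirDeriv (v, 0) f = fun z => ∑ k, v k • dirDeriv (spaceDir k) f z := by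
  ext z
  simp [dirDeriv, mk_zero_eq_sum v]

theorem dirDeriv_dirDeriv_mk_zero (hΩ : IsOpen Ω) {f : EuclideanSpace ℝ (Fin n) × ℝ → ℝ}
    (hf : ContDiffOn ℝ ∞ f Ω) (v : EuclideanSpace ℝ (Fin n)) {z} (hz : z ∈ Ω) :
    dirDeriv (v, 0) (dirDeriv (v, 0) f) z = v.ofLp ⬝ᵥ (spaceHessian f z).mulVec v.ofLp := by
  rw [dirDeriv_mk_zero (dirDeriv (v, 0) f)]
  simp only [dotProduct, Matrix.mulVec, spaceHessian, Matrix.of_apply, smul_eq_mul]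
  refine Finset.sum_congr rfl fun i _ => ?_
  rw [dirDeriv_mk_zero f, dirDeriv_sum_smul hΩ _ _ (fun k _ => contDiffOn_dirDeriv hΩ hf _) _ hz]
  simp [mul_comm]

/-- At a spatial maximum of `√w (tr A + ⟨y, A y⟩)`, `w = 1 + |y|²`, at the origin, the Hessian of
`tr A` is bounded above by `-(tr A) I - 2 A`. -/
theorem hessian_trace_le (hΩ : IsOpen Ω) (h₀ : ((0 : EuclideanSpace ℝ (Fin n)), t₀) ∈ Ω)
    (hu : ContDiffOn ℝ ∞ u Ω)
    (hmax : ∀ z ∈ Ω, z.2 ≤ t₀ →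
      √(1 + ‖z.1‖ ^ 2) * ((spaceHessian u z).trace +
        z.1.ofLp ⬝ᵥ (spaceHessian u z).mulVec z.1.ofLp) ≤ (spaceHessian u (0, t₀)).trace)
    (v : EuclideanSpace ℝ (Fin n)) :
    v.ofLp ⬝ᵥ (spaceHessian (fun z => (spaceHessian u z).trace) (0, t₀)).mulVec v.ofLp ≤
      -(‖v‖ ^ 2 * (spaceHessian u (0, t₀)).trace) -
        2 * (v.ofLp ⬝ᵥ (spaceHessian u (0, t₀)).mulVec v.ofLp) := by
  set z₀ : EuclideanSpace ℝ (Fin n) × ℝ := (0, t₀) with hz₀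
  have hS := contDiffOn_spaceHessian_trace hΩ hu
  set S := fun z => (spaceHessian u z).trace with hSdef
  have hd : EqOn (fun z => dirDeriv (v, 0) (dirDeriv (v, 0) u) z)
      (fun z => v.ofLp ⬝ᵥ (spaceHessian u z).mulVec v.ofLp) Ω := fun z hz =>
    dirDeriv_dirDeriv_mk_zero hΩ hu v hz
  set a := fun z => v.ofLp ⬝ᵥ (spaceHessian u z).mulVec v.ofLp with ha
  have hacont : ContinuousOn a Ω := (((contDiffOn_dirDeriv hΩ (contDiffOn_dirDeriv hΩ hu _) _
    ).congr fun z hz => (hd hz).symm)).continuousOn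
  rw [← dirDeriv_dirDeriv_mk_zero hΩ hS v h₀]
  have hline : ∀ σ : ℝ, Tendsto (fun s : ℝ => z₀ + (σ * s) • (v, (0 : ℝ))) (𝓝[>] 0) (𝓝 z₀) := by
    intro σ
    have : Continuous fun s : ℝ => z₀ + (σ * s) • (v, (0 : ℝ)) := by fun_prop
    simpa using (this.tendsto 0).mono_left nhdsWithin_le_nhds
  have haz : ∀ σ : ℝ, Tendsto (fun s : ℝ => a (z₀ + (σ * s) • (v, (0 : ℝ)))) (𝓝[>] 0)
      (𝓝 (a z₀)) := fun σ =>
    (hacont.continuousAt (hΩ.mem_nhds h₀)).tendsto.comp (hline σ)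
  have hmem : ∀ σ : ℝ, ∀ᶠ s : ℝ in 𝓝[>] 0, z₀ + (σ * s) • (v, (0 : ℝ)) ∈ Ω := fun σ =>
    (hline σ).eventually (hΩ.mem_nhds h₀)
  have hlim := ((tendsto_rpow_sub_one_div_sq (‖v‖ ^ 2) (-(1 / 2))).const_mul (2 * S z₀)).sub
    ((haz 1).add (haz (-1)))
  have hkey := le_of_tendsto_of_tendsto (tendsto_second_difference hΩ hS (v, 0) h₀) hlim ?_
  · simp only [ha, hSdef] at hkey ⊢
    linarith
  filter_upwards [hmem 1, hmem (-1), self_mem_nhdsWithin] with s h1 h2 hs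
  have hs0 : (0 : ℝ) < s := hs
  have hw : (0 : ℝ) < 1 + ‖v‖ ^ 2 * s ^ 2 := by positivity
  have bound : ∀ σ : ℝ, σ ^ 2 = 1 → z₀ + (σ * s) • (v, (0 : ℝ)) ∈ Ω →
      S (z₀ + (σ * s) • (v, (0 : ℝ))) + s ^ 2 * a (z₀ + (σ * s) • (v, (0 : ℝ))) ≤
        S z₀ * (1 + ‖v‖ ^ 2 * s ^ 2) ^ (-(1 / 2) : ℝ) := by
    intro σ hσ hm
    have h := hmax _ hm (by simp [hz₀])
    have hz1 : (z₀ + (σ * s) • (v, (0 : ℝ))).1 = (σ * s) • v := by simp [hz₀]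
    rw [hz1, WithLp.ofLp_smul, Matrix.mulVec_smul, smul_dotProduct, dotProduct_smul, norm_smul,
      mul_pow, Real.norm_eq_abs, sq_abs, mul_pow, hσ, one_mul, smul_eq_mul, smul_eq_mul,
      ← mul_assoc (σ * s), ← sq (σ * s), mul_pow, hσ, one_mul, mul_comm (s ^ 2) (‖v‖ ^ 2)] at h
    rw [Real.rpow_neg hw.le, ← Real.sqrt_eq_rpow, ← div_eq_mul_inv,
      le_div_iff₀ (Real.sqrt_pos.2 hw), mul_comm]
    exact h
  have b1 := bound 1 (by norm_num) h1
  have b2 := bound (-1) (by norm_num) h2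
  simp only [one_mul, neg_mul] at b1 b2 ⊢
  rw [div_le_iff₀ (by positivity), sub_mul, mul_assoc, div_mul_cancel₀ _ (by positivity)]
  linarith

/-- The time derivative of the trace is nonnegative at a maximum over all earlier times. -/
theorem dirDeriv_time_trace_nonneg (hΩ : IsOpen Ω)
    (h₀ : ((0 : EuclideanSpace ℝ (Fin n)), t₀) ∈ Ω) (hu : ContDiffOn ℝ ∞ u Ω)
    (hmax : ∀ z ∈ Ω, z.2 ≤ t₀ →
      √(1 + ‖z.1‖ ^ 2) * ((spaceHessian u z).trace +
        z.1.ofLp ⬝ᵥ (spaceHessian u z).mulVec z.1.ofLp) ≤ (spaceHessian u (0, t₀)).trace) :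
    0 ≤ dirDeriv (0, 1) (fun z => (spaceHessian u z).trace) (0, t₀) := by
  have hS := contDiffOn_spaceHessian_trace hΩ hu
  have hder := hasDerivAt_line hΩ hS ((0 : EuclideanSpace ℝ (Fin n)), (1 : ℝ)) (z := (0, t₀))
    (s := 0) (by simpa using h₀)
  rw [zero_smul, add_zero] at hder
  have hslope := (hasDerivAt_iff_tendsto_slope.1 hder).mono_left
    (nhdsWithin_mono 0 (fun s (hs : s < (0 : ℝ)) => hs.ne) : 𝓝[<] (0 : ℝ) ≤ 𝓝[≠] 0)
  refine ge_of_tendsto hslope ?_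
  have hmem : ∀ᶠ s : ℝ in 𝓝 0,
      ((0 : EuclideanSpace ℝ (Fin n)), t₀) + s • ((0 : EuclideanSpace ℝ (Fin n)), (1 : ℝ)) ∈ Ω :=
    (show Continuous fun s : ℝ => ((0 : EuclideanSpace ℝ (Fin n)), t₀) +
      s • ((0 : EuclideanSpace ℝ (Fin n)), (1 : ℝ)) by fun_prop).continuousAt.eventually
      (by simpa using hΩ.mem_nhds h₀)
  filter_upwards [nhdsWithin_le_nhds hmem, self_mem_nhdsWithin] with s hs hneg
  have hs0 : s < 0 := hneg
  have h := hmax _ hs (by simpa using hs0.le)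
  simp only [Prod.smul_mk, smul_zero, smul_eq_mul, mul_one, Prod.mk_add_mk, add_zero] at h
  rw [slope_def_field]
  simp only [Prod.smul_mk, smul_zero, smul_eq_mul, mul_one, Prod.mk_add_mk, add_zero]
  refine div_nonneg_of_nonpos ?_ (by linarith)
  simp only [norm_zero, ne_eq, OfNat.ofNat_ne_zero, not_false_eq_true, zero_pow, add_zero,
    Real.sqrt_one, one_mul, WithLp.ofLp_zero, zero_dotProduct] at h
  linarith

/-- Commuting derivatives: `∂ᵥ` of the Laplacian of `u` is the Laplacian of `∂ᵥ u`. -/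
theorem dirDeriv_trace_comm (hΩ : IsOpen Ω) (hu : ContDiffOn ℝ ∞ u Ω)
    (v : EuclideanSpace ℝ (Fin n) × ℝ) :
    EqOn (dirDeriv v fun z => (spaceHessian u z).trace)
      (fun z => (spaceHessian (dirDeriv v u) z).trace) Ω := fun z hz => by
  have h1 := dirDeriv_sum_smul hΩ Finset.univ (fun _ : Fin n => (1 : ℝ))
    (f := fun k => dirDeriv (spaceDir k) (dirDeriv (spaceDir k) u))
    (fun k _ => contDiffOn_dirDeriv hΩ (contDiffOn_dirDeriv hΩ hu _) _) v hz
  simp only [one_smul] at h1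
  simp only [Matrix.trace, Matrix.diag, spaceHessian, Matrix.of_apply]
  rw [h1]
  refine Finset.sum_congr rfl fun k _ => ?_
  rw [dirDeriv_comm hΩ (contDiffOn_dirDeriv hΩ hu _) _ _ hz]
  exact dirDeriv_congr hΩ (dirDeriv_comm hΩ hu _ _) _ hz

/-- The Laplacian of `tr (B D²u)` for a constant matrix `B`. -/
theorem trace_spaceHessian_trace_mul (hΩ : IsOpen Ω) (hu : ContDiffOn ℝ ∞ u Ω)
    (B : Matrix (Fin n) (Fin n) ℝ) {z : EuclideanSpace ℝ (Fin n) × ℝ} (hz : z ∈ Ω) :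
    (spaceHessian (fun z => (B * spaceHessian u z).trace) z).trace =
      (B * spaceHessian (fun z => (spaceHessian u z).trace) z).trace := by
  have hent : ∀ i j, ContDiffOn ℝ ∞ (dirDeriv (spaceDir i) (dirDeriv (spaceDir j) u)) Ω :=
    fun i j => contDiffOn_dirDeriv hΩ (contDiffOn_dirDeriv hΩ hu _) _
  have hexp : (fun z => (B * spaceHessian u z).trace) = fun z => ∑ p : Fin n × Fin n,
      B p.1 p.2 • dirDeriv (spaceDir p.2) (dirDeriv (spaceDir p.1) u) z := by
    ext z
    simp [Matrix.trace, Matrix.mul_apply, spaceHessian, Fintype.sum_prod_type]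
  have hR : ∀ i j, spaceHessian (fun z => (spaceHessian u z).trace) z i j =
      (spaceHessian (dirDeriv (spaceDir i) (dirDeriv (spaceDir j) u)) z).trace := by
    intro i j
    have h1 := dirDeriv_congr hΩ (dirDeriv_trace_comm hΩ hu (spaceDir j)) (spaceDir i) hz
    rw [spaceHessian, Matrix.of_apply, h1]
    exact dirDeriv_trace_comm hΩ (contDiffOn_dirDeriv hΩ hu _) (spaceDir i) hz
  rw [hexp]
  have hL : ∀ k, dirDeriv (spaceDir k) (dirDeriv (spaceDir k) fun z => ∑ p : Fin n × Fin n,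
      B p.1 p.2 • dirDeriv (spaceDir p.2) (dirDeriv (spaceDir p.1) u) z) z =
      ∑ p : Fin n × Fin n, B p.1 p.2 • dirDeriv (spaceDir k) (dirDeriv (spaceDir k)
        (dirDeriv (spaceDir p.2) (dirDeriv (spaceDir p.1) u))) z := by
    intro k
    rw [dirDeriv_congr hΩ (dirDeriv_sum_smul hΩ Finset.univ _ (fun p _ => hent _ _) _) _ hz]
    exact dirDeriv_sum_smul hΩ Finset.univ _ (fun p _ => contDiffOn_dirDeriv hΩ (hent _ _) _) _ hz
  calc _ = ∑ k, ∑ p : Fin n × Fin n, B p.1 p.2 • dirDeriv (spaceDir k) (dirDeriv (spaceDir k)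
        (dirDeriv (spaceDir p.2) (dirDeriv (spaceDir p.1) u))) z :=
        Finset.sum_congr rfl fun k _ => hL k
    _ = ∑ p : Fin n × Fin n, B p.1 p.2 *
        spaceHessian (fun z => (spaceHessian u z).trace) z p.2 p.1 := by
        rw [Finset.sum_comm]
        refine Finset.sum_congr rfl fun p _ => ?_
        rw [← Finset.smul_sum, hR]
        rfl
    _ = _ := by
        rw [Fintype.sum_prod_type]
        rfl

/-- A bound on a quadratic form, traced against a positive definite matrix. -/
theorem trace_mul_le_of_quadratic_le {B P Q : Matrix (Fin n) (Fin n) ℝ} (hB : B.PosDef)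
    (h : ∀ v : Fin n → ℝ, v ⬝ᵥ P.mulVec v ≤ v ⬝ᵥ Q.mulVec v) :
    (B * P).trace ≤ (B * Q).trace := by
  obtain ⟨C, -, rfl⟩ := exists_isUnit_conjTranspose_mul_self hB
  have key : ∀ R : Matrix (Fin n) (Fin n) ℝ,
      (C.conjTranspose * C * R).trace = ∑ m, C m ⬝ᵥ R.mulVec (C m) := by
    intro R
    rw [Matrix.mul_assoc, Matrix.trace_mul_comm]
    simp only [Matrix.trace, Matrix.diag, Matrix.mul_apply, dotProduct, Matrix.mulVec,
      Matrix.conjTranspose_apply, star_trivial, Finset.sum_mul, Finset.mul_sum]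
    refine Finset.sum_congr rfl fun m _ => ?_
    rw [Finset.sum_comm]
    simp [mul_assoc]
  rw [key, key]
  exact Finset.sum_le_sum fun m _ => h _

/-- Let `u` solve `∂ₜu = -w ^ β (det A) ^ (-α)`, where `A = D²u > 0`, `w = 1 + |y|²` and
`2 β = 1 - α (n + 2)`; for the Legendre transform of a hypersurface this is the `α`-Gauss curvature
flow. Then `√w (tr A + ⟨y, A y⟩)`, which is the sum of the principal radii, does not attain at
`(0, t₀)` its maximum over earlier times. -/
theorem not_isMax_sumRadii_of_legendre (hn : 1 ≤ n) {α : ℝ} (hα : 0 < α) (hΩ : IsOpen Ω)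
    (h₀ : ((0 : EuclideanSpace ℝ (Fin n)), t₀) ∈ Ω) (hu : ContDiffOn ℝ ∞ u Ω)
    (hpd : ∀ z ∈ Ω, (spaceHessian u z).PosDef)
    (hflow : ∀ z ∈ Ω, dirDeriv (0, 1) u z =
      -((1 + ‖z.1‖ ^ 2) ^ ((1 - α * (n + 2)) / 2) * (spaceHessian u z).det ^ (-α)))
    (hmax : ∀ z ∈ Ω, z.2 ≤ t₀ →
      √(1 + ‖z.1‖ ^ 2) * ((spaceHessian u z).trace +
        z.1.ofLp ⬝ᵥ (spaceHessian u z).mulVec z.1.ofLp) ≤ (spaceHessian u (0, t₀)).trace) :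
    False := by
  have : Nonempty (Fin n) := ⟨⟨0, hn⟩⟩
  set z₀ : EuclideanSpace ℝ (Fin n) × ℝ := (0, t₀) with hz₀
  set β : ℝ := (1 - α * (n + 2)) / 2 with hβ
  have hA₀ := hpd z₀ h₀
  set A₀ := spaceHessian u z₀ with hA₀def
  set B := A₀⁻¹ with hB
  have hd₀ := hA₀.det_pos
  set c₀ := A₀.det ^ (-α) with hc₀
  have hc₀pos : 0 < c₀ := Real.rpow_pos_of_pos hd₀ _
  have hBA : B * A₀ = 1 := Matrix.nonsing_inv_mul _ hd₀.ne'.isUnit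
  set l := fun z => (B * spaceHessian u z).trace with hl
  have hlz₀ : l z₀ = n := by
    change (B * A₀).trace = n
    rw [hBA, Matrix.trace_one, Fintype.card_fin]
  have hlsm : ContDiffOn ℝ ∞ l Ω := by
    simp only [hl, Matrix.trace, Matrix.diag, Matrix.mul_apply, spaceHessian, Matrix.of_apply]
    exact ContDiffOn.sum fun i _ => ContDiffOn.sum fun j _ => contDiffOn_const.mul
      (contDiffOn_dirDeriv hΩ (contDiffOn_dirDeriv hΩ hu _) _)
  have hut := contDiffOn_dirDeriv hΩ hu (0, 1)
  -- the flow speed is compared with its tangent at `A₀`, whose second differences are explicit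
  have hsecond : ∀ k : Fin n, dirDeriv (spaceDir k) (dirDeriv (spaceDir k) (dirDeriv (0, 1) u)) z₀ ≤
      c₀ * (α * dirDeriv (spaceDir k) (dirDeriv (spaceDir k) l) z₀ - 2 * β) := by
    intro k
    have hw1 : Tendsto (fun s : ℝ => (1 + 1 * s ^ 2) ^ β) (𝓝[>] 0) (𝓝 1) := by
      have h : ContinuousAt (fun s : ℝ => (1 + 1 * s ^ 2) ^ β) 0 :=
        ContinuousAt.rpow_const (by fun_prop) (Or.inl (by simp))
      simpa using h.tendsto.mono_left nhdsWithin_le_nhds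
    have hlim := (((hw1.mul (tendsto_second_difference hΩ hlsm (spaceDir k) h₀)).const_mul α).sub
      ((tendsto_rpow_sub_one_div_sq 1 β).const_mul 2)).const_mul c₀
    rw [one_mul, one_mul] at hlim
    refine le_of_tendsto_of_tendsto (tendsto_second_difference hΩ hut (spaceDir k) h₀) hlim ?_
    have hmem : ∀ σ : ℝ, ∀ᶠ s : ℝ in 𝓝[>] 0, z₀ + (σ * s) • spaceDir k ∈ Ω := by
      intro σ
      have : Continuous fun s : ℝ => z₀ + (σ * s) • spaceDir k := by fun_prop
      exact nhdsWithin_le_nhds (this.continuousAt.eventually (by simpa using hΩ.mem_nhds h₀))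
    filter_upwards [hmem 1, hmem (-1), self_mem_nhdsWithin] with s h1 h2 hs
    have hs0 : (0 : ℝ) < s := hs
    have bound : ∀ σ : ℝ, σ ^ 2 = 1 → z₀ + (σ * s) • spaceDir k ∈ Ω →
        dirDeriv (0, 1) u (z₀ + (σ * s) • spaceDir k) ≤ -((1 + 1 * s ^ 2) ^ β *
          (c₀ * (1 + n * α - α * l (z₀ + (σ * s) • spaceDir k)))) := by
      intro σ hσ hm
      have hz1 : ‖(z₀ + (σ * s) • spaceDir k).1‖ ^ 2 = 1 * s ^ 2 := by
        simp [hz₀, spaceDir, norm_smul, mul_pow, hσ]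
      rw [hflow _ hm, hz1, neg_le_neg_iff]
      refine mul_le_mul_of_nonneg_left ?_ (Real.rpow_nonneg (by positivity) _)
      have := tangent_le_det_rpow_neg hA₀ (hpd _ hm) hα.le
      rwa [Fintype.card_fin] at this
    have b1 := bound 1 (by norm_num) h1
    have b2 := bound (-1) (by norm_num) h2
    have b0 : dirDeriv (0, 1) u z₀ = -c₀ := by
      rw [hflow _ h₀]; simp [hz₀, hc₀, hA₀def]
    rw [b0, hlz₀]
    simp only [one_mul, neg_mul] at b1 b2 ⊢
    rw [div_le_iff₀ (by positivity)]
    have hs2 : s ^ 2 ≠ 0 := by positivity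
    have hrhs : c₀ * (α * ((1 + s ^ 2) ^ β * ((l (z₀ + s • spaceDir k) +
          l (z₀ + -s • spaceDir k) - 2 * n) / s ^ 2)) -
          2 * (((1 + s ^ 2) ^ β - 1) / s ^ 2)) * s ^ 2 =
        c₀ * (α * ((1 + s ^ 2) ^ β * (l (z₀ + s • spaceDir k) +
          l (z₀ + -s • spaceDir k) - 2 * n)) - 2 * ((1 + s ^ 2) ^ β - 1)) := by
      field_simp
    rw [hrhs]
    linarith
  have hsum : (spaceHessian (dirDeriv (0, 1) u) z₀).trace ≤
      c₀ * (α * (spaceHessian l z₀).trace - 2 * β * n) := by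
    calc (spaceHessian (dirDeriv (0, 1) u) z₀).trace
        ≤ ∑ k : Fin n, c₀ * (α * dirDeriv (spaceDir k) (dirDeriv (spaceDir k) l) z₀ - 2 * β) :=
          Finset.sum_le_sum fun k _ => hsecond k
      _ = _ := by
          rw [← Finset.mul_sum, Finset.sum_sub_distrib, ← Finset.mul_sum]
          simp [Matrix.trace, spaceHessian]
          left; ring
  have hcomm := dirDeriv_trace_comm hΩ hu (0, 1) h₀
  simp only at hcomm
  rw [← hcomm, trace_spaceHessian_trace_mul hΩ hu B h₀] at hsum
  have htime := dirDeriv_time_trace_nonneg hΩ h₀ hu hmax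
  have hquad : (B * spaceHessian (fun z => (spaceHessian u z).trace) z₀).trace ≤
      (B * ((-A₀.trace) • (1 : Matrix (Fin n) (Fin n) ℝ) - (2 : ℝ) • A₀)).trace := by
    refine trace_mul_le_of_quadratic_le hA₀.inv fun v => ?_
    have h := hessian_trace_le hΩ h₀ hu hmax (WithLp.toLp 2 v)
    have hv : ‖WithLp.toLp 2 v‖ ^ 2 = v ⬝ᵥ v := by
      rw [EuclideanSpace.norm_sq_eq]
      simp [dotProduct, sq]
    rw [hv] at h
    simp only [Matrix.sub_mulVec, Matrix.smul_mulVec, Matrix.one_mulVec, dotProduct_sub,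
      dotProduct_smul, smul_eq_mul]
    linarith
  rw [mul_sub, Matrix.trace_sub, Matrix.mul_smul, Matrix.mul_smul, hBA, mul_one, Matrix.trace_smul,
    Matrix.trace_smul, Matrix.trace_one, Fintype.card_fin, smul_eq_mul, smul_eq_mul] at hquad
  have hcs := card_sq_le_trace_inv_mul_trace hA₀
  rw [Fintype.card_fin] at hcs
  have hn' : (1 : ℝ) ≤ n := by exact_mod_cast hn
  have hneg :
      α * (B * spaceHessian (fun z => (spaceHessian u z).trace) z₀).trace - 2 * β * n < 0 := by
    have h1 : (B * spaceHessian (fun z => (spaceHessian u z).trace) z₀).trace ≤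
        -(n : ℝ) ^ 2 - 2 * n := by linarith
    have h2 := mul_le_mul_of_nonneg_left h1 hα.le
    have h3 : α * (-(n : ℝ) ^ 2 - 2 * n) - 2 * β * n = -n := by rw [hβ]; ring
    linarith
  have := mul_neg_of_pos_of_neg hc₀pos hneg
  linarith

end MaximumPrinciple

/-! ### Hypersurfaces parametrized by the Gauss map -/

section Legendre

variable {n : ℕ}

/-- The induced metric of a parametrized hypersurface `F : ℝⁿ → ℝⁿ⁺¹`. -/
noncomputable def paramMetric
    (F : EuclideanSpace ℝ (Fin n) → EuclideanSpace ℝ (Fin (n + 1)))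
    (y : EuclideanSpace ℝ (Fin n)) : Matrix (Fin n) (Fin n) ℝ :=
  Matrix.of fun i j => inner ℝ (partialDeriv i F y) (partialDeriv j F y)

/-- The second fundamental form of a parametrized hypersurface `F : ℝⁿ → ℝⁿ⁺¹` at `y`, where `N` is
the value of the normal. -/
noncomputable def paramSecondForm
    (F : EuclideanSpace ℝ (Fin n) → EuclideanSpace ℝ (Fin (n + 1)))
    (y : EuclideanSpace ℝ (Fin n)) (N : EuclideanSpace ℝ (Fin (n + 1))) :
    Matrix (Fin n) (Fin n) ℝ :=
  Matrix.of fun i j => -inner ℝ (partialDeriv i (partialDeriv j F) y) N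

variable {Ω : Set (EuclideanSpace ℝ (Fin n) × ℝ)}
  {Φ : EuclideanSpace ℝ (Fin n) × ℝ → EuclideanSpace ℝ (Fin (n + 1))}

theorem hasFDerivAt_slice {F : Type*} [NormedAddCommGroup F] [NormedSpace ℝ F]
    {f : EuclideanSpace ℝ (Fin n) × ℝ → F} {y : EuclideanSpace ℝ (Fin n)} {t : ℝ}
    (hf : DifferentiableAt ℝ f (y, t)) :
    HasFDerivAt (fun y => f (y, t)) ((fderiv ℝ f (y, t)).comp
      (ContinuousLinearMap.inl ℝ (EuclideanSpace ℝ (Fin n)) ℝ)) y :=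
  hf.hasFDerivAt.comp y (hasFDerivAt_prodMk_left y t)

theorem partialDeriv_slice (hΩ : IsOpen Ω) (hΦ : ContDiffOn ℝ ∞ Φ Ω) (i : Fin n)
    {y : EuclideanSpace ℝ (Fin n)} {t : ℝ} (h : (y, t) ∈ Ω) :
    partialDeriv i (fun y => Φ (y, t)) y = dirDeriv (spaceDir i) Φ (y, t) := by
  rw [partialDeriv, (hasFDerivAt_slice (differentiableAt_of_contDiffOn hΩ hΦ h)).fderiv]
  simp [dirDeriv, spaceDir]

theorem partialDeriv_partialDeriv_slice (hΩ : IsOpen Ω) (hΦ : ContDiffOn ℝ ∞ Φ Ω) (i j : Fin n)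
    {y : EuclideanSpace ℝ (Fin n)} {t : ℝ} (h : (y, t) ∈ Ω) :
    partialDeriv i (partialDeriv j fun y => Φ (y, t)) y =
      dirDeriv (spaceDir i) (dirDeriv (spaceDir j) Φ) (y, t) := by
  rw [← partialDeriv_slice hΩ (contDiffOn_dirDeriv hΩ hΦ _) i h, partialDeriv, partialDeriv]
  congr 1
  refine Filter.EventuallyEq.fderiv_eq ?_
  have : ∀ᶠ y' in 𝓝 y, (y', t) ∈ Ω :=
    (show Continuous fun y' : EuclideanSpace ℝ (Fin n) => (y', t) by
      fun_prop).continuousAt.eventually (hΩ.mem_nhds h)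
  filter_upwards [this] with y' hy'
  exact partialDeriv_slice hΩ hΦ j hy'

theorem dirDeriv_inner {V F : Type*} [NormedAddCommGroup V] [NormedSpace ℝ V]
    [NormedAddCommGroup F] [InnerProductSpace ℝ F] {f g : V → F} {z : V}
    (hf : DifferentiableAt ℝ f z) (hg : DifferentiableAt ℝ g z) (v : V) :
    dirDeriv v (fun z => inner ℝ (f z) (g z)) z =
      inner ℝ (dirDeriv v f z) (g z) + inner ℝ (f z) (dirDeriv v g z) := by
  unfold dirDeriv
  rw [fderiv_inner_apply ℝ hf hg, add_comm]

/-- The upward, not normalized, normal with coordinates `(y, 1)` in an orthonormal basis. -/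
noncomputable def graphNormal
    (b : OrthonormalBasis (Fin (n + 1)) ℝ (EuclideanSpace ℝ (Fin (n + 1))))
    (y : EuclideanSpace ℝ (Fin n)) : EuclideanSpace ℝ (Fin (n + 1)) :=
  ∑ i, y i • b i.castSucc + b (Fin.last n)

variable {b : OrthonormalBasis (Fin (n + 1)) ℝ (EuclideanSpace ℝ (Fin (n + 1)))}

theorem hasFDerivAt_graphNormal (y : EuclideanSpace ℝ (Fin n)) :
    HasFDerivAt (graphNormal b) (∑ i, (EuclideanSpace.proj (𝕜 := ℝ) i :
      EuclideanSpace ℝ (Fin n) →L[ℝ] ℝ).smulRight (b i.castSucc)) y := by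
  unfold graphNormal
  refine HasFDerivAt.add_const _ (HasFDerivAt.fun_sum fun i _ => ?_)
  exact ((EuclideanSpace.proj (𝕜 := ℝ) i : EuclideanSpace ℝ (Fin n) →L[ℝ] ℝ).smulRight
    (b i.castSucc)).hasFDerivAt

theorem contDiff_graphNormal : ContDiff ℝ ∞ (graphNormal b) := by
  unfold graphNormal
  fun_prop

theorem dirDeriv_graphNormal_comp {V : Type*} [NormedAddCommGroup V] [NormedSpace ℝ V]
    {f : V → EuclideanSpace ℝ (Fin n)} {z : V} (hf : DifferentiableAt ℝ f z) (v : V) :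
    dirDeriv v (fun z => graphNormal b (f z)) z = ∑ i, dirDeriv v f z i • b i.castSucc := by
  have := ((hasFDerivAt_graphNormal (b := b) (f z)).comp z hf.hasFDerivAt).fderiv
  unfold dirDeriv
  rw [show (fun z => graphNormal b (f z)) = graphNormal b ∘ f from rfl, this]
  simp

theorem inner_graphNormal (x : EuclideanSpace ℝ (Fin (n + 1))) (y : EuclideanSpace ℝ (Fin n)) :
    inner ℝ x (graphNormal b y) =
      ∑ i, y i * inner ℝ x (b i.castSucc) + inner ℝ x (b (Fin.last n)) := by
  simp [graphNormal, inner_add_right, inner_sum, inner_smul_right]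

/-- The support function `⟨Φ, (y, 1)⟩` of a moving hypersurface in dehomogenized coordinates: the
Legendre transform of its graph representation. -/
noncomputable def legendre (b : OrthonormalBasis (Fin (n + 1)) ℝ (EuclideanSpace ℝ (Fin (n + 1))))
    (Φ : EuclideanSpace ℝ (Fin n) × ℝ → EuclideanSpace ℝ (Fin (n + 1)))
    (z : EuclideanSpace ℝ (Fin n) × ℝ) : ℝ :=
  inner ℝ (Φ z) (graphNormal b z.1)

theorem contDiffOn_legendre (hΦ : ContDiffOn ℝ ∞ Φ Ω) : ContDiffOn ℝ ∞ (legendre b Φ) Ω :=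
  hΦ.inner ℝ ((contDiff_graphNormal.comp contDiff_fst).contDiffOn)

theorem dirDeriv_legendre (hΩ : IsOpen Ω) (hΦ : ContDiffOn ℝ ∞ Φ Ω)
    {z : EuclideanSpace ℝ (Fin n) × ℝ} (hz : z ∈ Ω) (v : EuclideanSpace ℝ (Fin n) × ℝ) :
    dirDeriv v (legendre b Φ) z = inner ℝ (dirDeriv v Φ z) (graphNormal b z.1) +
      ∑ i, v.1 i * inner ℝ (Φ z) (b i.castSucc) := by
  have h1 : DifferentiableAt ℝ (fun z : EuclideanSpace ℝ (Fin n) × ℝ => graphNormal b z.1) z :=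
    ((contDiff_graphNormal.comp contDiff_fst).differentiable (by simp)) z
  unfold legendre
  rw [dirDeriv_inner (differentiableAt_of_contDiffOn hΩ hΦ hz) h1,
    dirDeriv_graphNormal_comp differentiableAt_fst]
  congr 1
  simp [dirDeriv, inner_sum, inner_smul_right, fderiv_fst]

theorem dirDeriv_space_legendre (hΩ : IsOpen Ω) (hΦ : ContDiffOn ℝ ∞ Φ Ω)
    (hn : ∀ z ∈ Ω, ∀ k, inner ℝ (dirDeriv (spaceDir k) Φ z) (graphNormal b z.1) = 0) (k : Fin n) :
    EqOn (dirDeriv (spaceDir k) (legendre b Φ)) (fun z => inner ℝ (Φ z) (b k.castSucc)) Ω :=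
  fun z hz => by
    rw [dirDeriv_legendre hΩ hΦ hz, hn z hz k, zero_add]
    simp [spaceDir]

theorem spaceHessian_legendre (hΩ : IsOpen Ω) (hΦ : ContDiffOn ℝ ∞ Φ Ω)
    (hn : ∀ z ∈ Ω, ∀ k, inner ℝ (dirDeriv (spaceDir k) Φ z) (graphNormal b z.1) = 0)
    {z : EuclideanSpace ℝ (Fin n) × ℝ} (hz : z ∈ Ω) (i j : Fin n) :
    spaceHessian (legendre b Φ) z i j = inner ℝ (dirDeriv (spaceDir i) Φ z) (b j.castSucc) := by
  rw [spaceHessian, Matrix.of_apply,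
    dirDeriv_congr hΩ (dirDeriv_space_legendre hΩ hΦ hn j) (spaceDir i) hz,
    dirDeriv_inner (differentiableAt_of_contDiffOn hΩ hΦ hz) (differentiableAt_const _)]
  simp [dirDeriv]

theorem spaceHessian_symm (hΩ : IsOpen Ω) {u : EuclideanSpace ℝ (Fin n) × ℝ → ℝ}
    (hu : ContDiffOn ℝ ∞ u Ω) {z : EuclideanSpace ℝ (Fin n) × ℝ} (hz : z ∈ Ω) :
    (spaceHessian u z).transpose = spaceHessian u z := by
  ext i j
  exact dirDeriv_comm hΩ hu _ _ hz

theorem paramMetric_eq (hΩ : IsOpen Ω) (hΦ : ContDiffOn ℝ ∞ Φ Ω)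
    (hn : ∀ z ∈ Ω, ∀ k, inner ℝ (dirDeriv (spaceDir k) Φ z) (graphNormal b z.1) = 0)
    {y : EuclideanSpace ℝ (Fin n)} {t : ℝ} (hz : (y, t) ∈ Ω) :
    paramMetric (fun y => Φ (y, t)) y = spaceHessian (legendre b Φ) (y, t) *
      (1 + Matrix.vecMulVec y.ofLp y.ofLp) * spaceHessian (legendre b Φ) (y, t) := by
  set A := spaceHessian (legendre b Φ) (y, t) with hA
  have hsymm : A.transpose = A := spaceHessian_symm hΩ (contDiffOn_legendre hΦ) hz
  have hlast : ∀ i, inner ℝ (dirDeriv (spaceDir i) Φ (y, t)) (b (Fin.last n)) =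
      -(A.mulVec y.ofLp) i := by
    intro i
    have h := hn _ hz i
    rw [inner_graphNormal] at h
    simp only [← spaceHessian_legendre hΩ hΦ hn hz] at h
    simp only [Matrix.mulVec, dotProduct]
    simp only [← hA, mul_comm] at h ⊢
    linarith
  have h1 : A * (1 + Matrix.vecMulVec y.ofLp y.ofLp) * A =
      A * A.transpose + Matrix.vecMulVec (A.mulVec y.ofLp) (A.mulVec y.ofLp) := by
    rw [mul_add, add_mul, mul_one, hsymm, Matrix.mul_vecMulVec, Matrix.vecMulVec_mul]
    congr 2
    rw [← Matrix.mulVec_transpose, hsymm]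
  rw [h1]
  ext i j
  rw [paramMetric, Matrix.of_apply, partialDeriv_slice hΩ hΦ i hz, partialDeriv_slice hΩ hΦ j hz,
    ← b.sum_inner_mul_inner, Fin.sum_univ_castSucc, real_inner_comm _ (b (Fin.last n)), hlast,
    hlast, Matrix.add_apply, Matrix.mul_apply, Matrix.vecMulVec_apply]
  congr 1
  · refine Finset.sum_congr rfl fun k _ => ?_
    rw [real_inner_comm _ (b k.castSucc), ← spaceHessian_legendre hΩ hΦ hn hz,
      ← spaceHessian_legendre hΩ hΦ hn hz]
    rfl
  · ring

theorem paramSecondForm_eq (hΩ : IsOpen Ω) (hΦ : ContDiffOn ℝ ∞ Φ Ω)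
    (hn : ∀ z ∈ Ω, ∀ k, inner ℝ (dirDeriv (spaceDir k) Φ z) (graphNormal b z.1) = 0)
    {y : EuclideanSpace ℝ (Fin n)} {t : ℝ} (hz : (y, t) ∈ Ω) (c : ℝ) :
    paramSecondForm (fun y => Φ (y, t)) y (c • graphNormal b y) =
      c • spaceHessian (legendre b Φ) (y, t) := by
  have hsymm := spaceHessian_symm hΩ (contDiffOn_legendre (b := b) hΦ) hz
  rw [← hsymm]
  ext i j
  have h0 : EqOn (fun z => inner ℝ (dirDeriv (spaceDir j) Φ z) (graphNormal b z.1))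
      (fun _ => 0) Ω := fun z hz => hn z hz j
  have h := dirDeriv_congr hΩ h0 (spaceDir i) hz
  have h1 : DifferentiableAt ℝ (fun z : EuclideanSpace ℝ (Fin n) × ℝ => graphNormal b z.1) (y, t) :=
    ((contDiff_graphNormal.comp contDiff_fst).differentiable (by simp)) _
  rw [dirDeriv_inner (differentiableAt_of_contDiffOn hΩ (contDiffOn_dirDeriv hΩ hΦ _) hz) h1,
    dirDeriv_graphNormal_comp differentiableAt_fst] at h
  rw [paramSecondForm, Matrix.of_apply, partialDeriv_partialDeriv_slice hΩ hΦ i j hz,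
    inner_smul_right, Matrix.smul_apply, Matrix.transpose_apply,
    spaceHessian_legendre hΩ hΦ hn hz, smul_eq_mul]
  simp [dirDeriv, fderiv_fst, spaceDir] at h
  simp only [dirDeriv, spaceDir] at h ⊢
  linear_combination c * -h

theorem one_add_norm_sq_eq (y : EuclideanSpace ℝ (Fin n)) :
    1 + ‖y‖ ^ 2 = 1 + y.ofLp ⬝ᵥ y.ofLp := by
  rw [EuclideanSpace.norm_sq_eq]
  simp [dotProduct, sq]

/-- The sum of the principal radii in terms of the Hessian of the Legendre transform. -/
theorem trace_inv_mul_of_legendre {A : Matrix (Fin n) (Fin n) ℝ} (hA : A.PosDef)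
    (y : EuclideanSpace ℝ (Fin n)) :
    (((√(1 + ‖y‖ ^ 2))⁻¹ • A)⁻¹ * (A * (1 + Matrix.vecMulVec y.ofLp y.ofLp) * A)).trace =
      √(1 + ‖y‖ ^ 2) * (A.trace + y.ofLp ⬝ᵥ A.mulVec y.ofLp) := by
  have hw : √(1 + ‖y‖ ^ 2) ≠ 0 := (Real.sqrt_pos.2 (by positivity)).ne'
  have hdet : IsUnit A.det := hA.det_pos.ne'.isUnit
  have hinv : ((√(1 + ‖y‖ ^ 2))⁻¹ • A)⁻¹ = √(1 + ‖y‖ ^ 2) • A⁻¹ := by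
    refine Matrix.inv_eq_right_inv ?_
    rw [Matrix.smul_mul, Matrix.mul_smul, smul_smul, inv_mul_cancel₀ hw, one_smul,
      Matrix.mul_nonsing_inv _ hdet]
  rw [hinv, Matrix.smul_mul, Matrix.trace_smul, smul_eq_mul, mul_assoc A, ← mul_assoc A⁻¹,
    Matrix.nonsing_inv_mul _ hdet, one_mul, add_mul, one_mul, Matrix.trace_add,
    Matrix.vecMulVec_mul, Matrix.trace_vecMulVec,
    dotProduct_comm y.ofLp (Matrix.vecMul _ _), ← Matrix.dotProduct_mulVec]

/-- The Gauss curvature in terms of the Hessian of the Legendre transform. -/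
theorem det_inv_mul_of_legendre {A : Matrix (Fin n) (Fin n) ℝ} (hA : A.PosDef)
    (y : EuclideanSpace ℝ (Fin n)) :
    ((A * (1 + Matrix.vecMulVec y.ofLp y.ofLp) * A)⁻¹ * ((√(1 + ‖y‖ ^ 2))⁻¹ • A)).det =
      ((1 + ‖y‖ ^ 2) ^ (((n : ℝ) + 2) / 2) * A.det)⁻¹ := by
  have hw : 0 < 1 + ‖y‖ ^ 2 := by positivity
  have hd := hA.det_pos
  have h1 : (1 + Matrix.vecMulVec y.ofLp y.ofLp).det = 1 + ‖y‖ ^ 2 := by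
    rw [one_add_norm_sq_eq, Matrix.vecMulVec_eq Unit,
      Matrix.det_one_add_replicateCol_mul_replicateRow]
  generalize 1 + ‖y‖ ^ 2 = w at hw h1 ⊢
  rw [Matrix.det_mul, Matrix.det_nonsing_inv, Matrix.det_smul, Matrix.det_mul, Matrix.det_mul, h1,
    Ring.inverse_eq_inv', Fintype.card_fin, inv_pow, Real.sqrt_eq_rpow, ← Real.rpow_natCast,
    ← Real.rpow_mul hw.le, show ((n : ℝ) + 2) / 2 = 1 / 2 * n + 1 by ring, Real.rpow_add hw,
    Real.rpow_one]
  have : w ^ (1 / 2 * (n : ℝ)) ≠ 0 := (Real.rpow_pos_of_pos hw _).ne'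
  field_simp

end Legendre

/-! ### Coordinates given by the Gauss map -/

section GaussCoordinates

variable {n : ℕ}

theorem contDiffOn_matrix_inv {V : Type*} [NormedAddCommGroup V] [NormedSpace ℝ V] {U : Set V}
    {ι : Type*} [Fintype ι] [DecidableEq ι] {A : V → Matrix ι ι ℝ}
    (hA : ∀ i j, ContDiffOn ℝ ∞ (fun z => A z i j) U) (hdet : ∀ z ∈ U, (A z).det ≠ 0) (i j : ι) :
    ContDiffOn ℝ ∞ (fun z => (A z)⁻¹ i j) U := by
  have det_smooth : ∀ B : V → Matrix ι ι ℝ, (∀ i j, ContDiffOn ℝ ∞ (fun z => B z i j) U) →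
      ContDiffOn ℝ ∞ (fun z => (B z).det) U := by
    intro B hB
    simp only [Matrix.det_apply]
    exact ContDiffOn.sum fun σ _ => (contDiffOn_prod fun k _ => hB _ _).const_smul _
  simp only [Matrix.inv_def, Ring.inverse_eq_inv', Matrix.smul_apply, smul_eq_mul,
    Matrix.adjugate_apply]
  refine ((det_smooth A hA).inv hdet).mul (det_smooth _ fun k l => ?_)
  simp only [Matrix.updateRow_apply]
  split_ifs
  · exact contDiffOn_const
  · exact hA k l

variable {Ω : Set (EuclideanSpace ℝ (Fin n) × ℝ)}
  {Φ N : EuclideanSpace ℝ (Fin n) × ℝ → EuclideanSpace ℝ (Fin (n + 1))}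

theorem exists_orthonormalBasis_last_eq {x : EuclideanSpace ℝ (Fin (n + 1))} (hx : ‖x‖ = 1) :
    ∃ b : OrthonormalBasis (Fin (n + 1)) ℝ (EuclideanSpace ℝ (Fin (n + 1))),
      b (Fin.last n) = x := by
  have h : Orthonormal ℝ (({Fin.last n} : Set (Fin (n + 1))).domRestrict fun _ => x) :=
    ⟨fun _ => hx, fun i j hij => (hij (Subsingleton.elim i j)).elim⟩
  obtain ⟨b, hb⟩ := h.exists_orthonormalBasis_extension_of_card_eq (by simp)
  exact ⟨b, hb _ rfl⟩

/-- The coordinates `y` of the normal line of `N = c (y, 1)`. -/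
noncomputable def normalSlope
    (b : OrthonormalBasis (Fin (n + 1)) ℝ (EuclideanSpace ℝ (Fin (n + 1))))
    (N : EuclideanSpace ℝ (Fin (n + 1))) : EuclideanSpace ℝ (Fin n) :=
  WithLp.toLp 2 fun i => inner ℝ N (b i.castSucc) / inner ℝ N (b (Fin.last n))

variable {b : OrthonormalBasis (Fin (n + 1)) ℝ (EuclideanSpace ℝ (Fin (n + 1)))}

theorem eq_smul_graphNormal_normalSlope {x : EuclideanSpace ℝ (Fin (n + 1))}
    (hx : inner ℝ x (b (Fin.last n)) ≠ 0) :
    x = inner ℝ x (b (Fin.last n)) • graphNormal b (normalSlope b x) := by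
  conv_lhs => rw [← b.sum_repr' x, Fin.sum_univ_castSucc]
  rw [graphNormal, smul_add, Finset.smul_sum, real_inner_comm x]
  congr 1
  refine Finset.sum_congr rfl fun i _ => ?_
  rw [smul_smul, real_inner_comm x]
  simp only [normalSlope]
  rw [mul_div_cancel₀ _ hx]

theorem norm_graphNormal (y : EuclideanSpace ℝ (Fin n)) :
    ‖graphNormal b y‖ = √(1 + ‖y‖ ^ 2) := by
  rw [← Real.sqrt_sq (norm_nonneg (graphNormal b y)), ← real_inner_self_eq_norm_sq,
    ← b.sum_inner_mul_inner, Fin.sum_univ_castSucc, one_add_norm_sq_eq, add_comm]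
  have h1 : ∀ i, inner ℝ (graphNormal b y) (b i.castSucc) = y i := by
    intro i
    rw [real_inner_comm, inner_graphNormal]
    simp [b.inner_eq_ite, Fin.castSucc_ne_last]
  have h2 : inner ℝ (graphNormal b y) (b (Fin.last n)) = 1 := by
    rw [real_inner_comm, inner_graphNormal]
    simp [b.inner_eq_ite, (Fin.castSucc_ne_last _).symm]
  simp only [real_inner_comm (graphNormal b y) (b _), h1, h2]
  simp [dotProduct]

theorem eq_inv_sqrt_smul_graphNormal {x : EuclideanSpace ℝ (Fin (n + 1))} (h1 : ‖x‖ = 1)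
    (hx : 0 < inner ℝ x (b (Fin.last n))) :
    x = (√(1 + ‖normalSlope b x‖ ^ 2))⁻¹ • graphNormal b (normalSlope b x) := by
  have h := eq_smul_graphNormal_normalSlope hx.ne'
  have hn := congr_arg norm h
  rw [h1, norm_smul, norm_graphNormal, Real.norm_of_nonneg hx.le] at hn
  rwa [eq_inv_of_mul_eq_one_left hn.symm] at h

/-- The normal of a smooth immersion is smooth: its slope solves a linear system with smooth
coefficients. -/
theorem contDiffOn_normalSlope (hΩ : IsOpen Ω) (hΦ : ContDiffOn ℝ ∞ Φ Ω)
    (hNt : ∀ z ∈ Ω, ∀ k, inner ℝ (dirDeriv (spaceDir k) Φ z) (N z) = 0) {U : Set _} (hU : U ⊆ Ω)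
    (hdet : ∀ z ∈ U, (Matrix.of fun i j : Fin n =>
      inner ℝ (dirDeriv (spaceDir i) Φ z) (b j.castSucc)).det ≠ 0)
    (hlast : ∀ z ∈ U, inner ℝ (N z) (b (Fin.last n)) ≠ 0) :
    ContDiffOn ℝ ∞ (fun z => normalSlope b (N z)) U := by
  have hsm : ∀ (i : Fin n) (x : EuclideanSpace ℝ (Fin (n + 1))),
      ContDiffOn ℝ ∞ (fun z => inner ℝ (dirDeriv (spaceDir i) Φ z) x) U := fun i x =>
    ((contDiffOn_dirDeriv hΩ hΦ _).mono hU).inner ℝ contDiffOn_const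
  set J : EuclideanSpace ℝ (Fin n) × ℝ → Matrix (Fin n) (Fin n) ℝ := fun z =>
    Matrix.of fun i j : Fin n => inner ℝ (dirDeriv (spaceDir i) Φ z) (b j.castSucc) with hJ
  have hinv := contDiffOn_matrix_inv (A := J) (fun i j => hsm i _) hdet
  have hsol : ∀ z ∈ U, ∀ i, normalSlope b (N z) i = ∑ j, (J z)⁻¹ i j *
      -inner ℝ (dirDeriv (spaceDir j) Φ z) (b (Fin.last n)) := by
    intro z hz i
    have hsys : (J z).mulVec (normalSlope b (N z)).ofLp =
        fun j => -inner ℝ (dirDeriv (spaceDir j) Φ z) (b (Fin.last n)) := by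
      ext j
      have h := hNt z (hU hz) j
      rw [eq_smul_graphNormal_normalSlope (hlast z hz), inner_smul_right, mul_eq_zero,
        or_iff_right (hlast z hz), inner_graphNormal] at h
      simp only [Matrix.mulVec, dotProduct, hJ, Matrix.of_apply]
      simp only [mul_comm] at h ⊢
      linarith
    have h2 := congr_arg (fun x => (J z)⁻¹.mulVec x) hsys
    have hJinv : (J z)⁻¹ * J z = 1 := Matrix.nonsing_inv_mul _ (hdet z hz).isUnit
    simp only [Matrix.mulVec_mulVec, hJinv, Matrix.one_mulVec] at h2
    exact congr_fun h2 i
  rw [contDiffOn_euclidean]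
  intro i
  exact (ContDiffOn.sum fun j _ => (hinv i j).mul (hsm j _).neg).congr fun z hz => hsol z hz i

/-- Near a point where the second fundamental form is positive definite, a moving hypersurface can
be parametrized by the slope of its normal, smoothly in space-time. -/
theorem exists_gaussCoordinates (hΩ : IsOpen Ω) (hΦ : ContDiffOn ℝ ∞ Φ Ω)
    (hNc : ContinuousOn N Ω) (hN1 : ∀ z ∈ Ω, ‖N z‖ = 1)
    (hNt : ∀ z ∈ Ω, ∀ k, inner ℝ (dirDeriv (spaceDir k) Φ z) (N z) = 0)
    (himm : ∀ z ∈ Ω, ∀ v : EuclideanSpace ℝ (Fin n), dirDeriv (v, 0) Φ z = 0 → v = 0)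
    {p₀ : EuclideanSpace ℝ (Fin n)} {t₀ : ℝ} (h₀ : (p₀, t₀) ∈ Ω)
    (hpd : (paramSecondForm (fun p => Φ (p, t₀)) p₀ (N (p₀, t₀))).PosDef) :
    ∃ (b : OrthonormalBasis (Fin (n + 1)) ℝ (EuclideanSpace ℝ (Fin (n + 1))))
      (Ω' : Set (EuclideanSpace ℝ (Fin n) × ℝ))
      (ψ : EuclideanSpace ℝ (Fin n) × ℝ → EuclideanSpace ℝ (Fin n) × ℝ),
      IsOpen Ω' ∧ (0, t₀) ∈ Ω' ∧ ContDiffOn ℝ ∞ ψ Ω' ∧ MapsTo ψ Ω' Ω ∧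
      (∀ z ∈ Ω', (ψ z).2 = z.2) ∧ ψ (0, t₀) = (p₀, t₀) ∧
      (∀ z ∈ Ω', N (ψ z) = (√(1 + ‖z.1‖ ^ 2))⁻¹ • graphNormal b z.1) ∧
      ∀ z ∈ Ω', ∀ v : EuclideanSpace ℝ (Fin n), dirDeriv (v, 0) ψ z = 0 → v = 0 := by
  set z₀ : EuclideanSpace ℝ (Fin n) × ℝ := (p₀, t₀) with hz₀
  obtain ⟨b, hb⟩ := exists_orthonormalBasis_last_eq (hN1 z₀ h₀)
  set J : EuclideanSpace ℝ (Fin n) × ℝ → Matrix (Fin n) (Fin n) ℝ := fun z =>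
    Matrix.of fun i j : Fin n => inner ℝ (dirDeriv (spaceDir i) Φ z) (b j.castSucc) with hJ
  have hDc : ∀ k : Fin n, ContinuousOn (dirDeriv (spaceDir k) Φ) Ω := fun k =>
    (contDiffOn_dirDeriv hΩ hΦ _).continuousOn
  have hJc : ContinuousOn (fun z => (J z).det) Ω := by
    have : ContinuousOn J Ω := continuousOn_pi.2 fun i => continuousOn_pi.2 fun j =>
      (hDc i).inner continuousOn_const
    exact (continuous_id.matrix_det).comp_continuousOn this
  have hLc : ContinuousOn (fun z => (inner ℝ (N z) (b (Fin.last n)) : ℝ)) Ω :=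
    hNc.inner continuousOn_const
  set Ω₁ := (Ω ∩ (fun z => (J z).det) ⁻¹' {0}ᶜ) ∩
    (Ω ∩ (fun z => (inner ℝ (N z) (b (Fin.last n)) : ℝ)) ⁻¹' Ioi 0) with hΩ₁
  have hΩ₁o : IsOpen Ω₁ := (hJc.isOpen_inter_preimage hΩ isOpen_compl_singleton).inter
    (hLc.isOpen_inter_preimage hΩ isOpen_Ioi)
  have hsub : Ω₁ ⊆ Ω := fun z hz => hz.1.1
  -- the tangent space at `z₀` is orthogonal to `b (Fin.last n) = N z₀`, so it projects isomorphically
  -- onto the span of the other basis vectors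
  have hdet₀ : (J z₀).det ≠ 0 := by
    intro h
    obtain ⟨v, hv0, hv⟩ := Matrix.exists_vecMul_eq_zero_iff.2 h
    refine hv0 ?_
    have hzero : dirDeriv (WithLp.toLp 2 v, (0 : ℝ)) Φ z₀ = 0 := by
      rw [← b.sum_repr' (dirDeriv (WithLp.toLp 2 v, (0 : ℝ)) Φ z₀)]
      refine Finset.sum_eq_zero fun i _ => ?_
      rw [dirDeriv_mk_zero, real_inner_comm, sum_inner]
      simp only [inner_smul_left, RCLike.conj_to_real]
      refine Fin.lastCases ?_ (fun j => ?_) i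
      · rw [hb]
        simp [hNt z₀ h₀]
      · have := congr_fun hv j
        simp only [Matrix.vecMul, dotProduct, hJ, Matrix.of_apply, Pi.zero_apply] at this
        rw [this, zero_smul]
    simpa using himm z₀ h₀ _ hzero
  have hz₀Ω₁ : z₀ ∈ Ω₁ := by
    refine ⟨⟨h₀, hdet₀⟩, h₀, ?_⟩
    simp [hb, hN1 z₀ h₀]
  set Y : EuclideanSpace ℝ (Fin n) × ℝ → EuclideanSpace ℝ (Fin n) :=
    fun z => normalSlope b (N z) with hY
  have hYs : ContDiffOn ℝ ∞ Y Ω₁ := contDiffOn_normalSlope hΩ hΦ hNt hsub (fun z hz => hz.1.2)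
    (fun z hz => (show (0 : ℝ) < _ from hz.2.2).ne')
  have hY₀ : Y z₀ = 0 := by
    ext i
    simp [hY, normalSlope, ← hb, b.inner_eq_ite, (Fin.castSucc_ne_last _).symm]
  have hnormal : ∀ z ∈ Ω₁, ∀ k, inner ℝ (dirDeriv (spaceDir k) Φ z) (graphNormal b (Y z)) = 0 := by
    intro z hz k
    have h := hNt z (hsub hz) k
    have hl : (inner ℝ (N z) (b (Fin.last n)) : ℝ) ≠ 0 := (show (0 : ℝ) < _ from hz.2.2).ne'
    rwa [eq_smul_graphNormal_normalSlope hl, inner_smul_right, mul_eq_zero, or_iff_right hl] at h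
  set Ψ : EuclideanSpace ℝ (Fin n) × ℝ → EuclideanSpace ℝ (Fin n) × ℝ := fun z => (Y z, z.2) with hΨ
  have hΨs : ContDiffOn ℝ ∞ Ψ Ω₁ := hYs.prodMk contDiffOn_snd
  have hYd : ∀ z ∈ Ω₁, DifferentiableAt ℝ Y z := fun z hz =>
    differentiableAt_of_contDiffOn hΩ₁o hYs hz
  have hΨd : ∀ z ∈ Ω₁, HasFDerivAt Ψ ((fderiv ℝ Y z).prod (ContinuousLinearMap.snd ℝ _ _)) z :=
    fun z hz => (hYd z hz).hasFDerivAt.prodMk hasFDerivAt_snd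
  -- differentiating the normality relation identifies the kernel of the derivative of the slope with
  -- the kernel of the second fundamental form
  have hinj : Function.Injective (fderiv ℝ Ψ z₀) := by
    rw [injective_iff_map_eq_zero]
    rintro ⟨v, s⟩ hvs
    rw [(hΨd z₀ hz₀Ω₁).fderiv] at hvs
    simp only [ContinuousLinearMap.prod_apply, ContinuousLinearMap.coe_snd', Prod.mk_eq_zero] at hvs
    obtain ⟨hv, rfl⟩ := hvs
    have hcol : ∀ k, inner ℝ (dirDeriv (v, 0) (dirDeriv (spaceDir k) Φ) z₀) (N z₀) = 0 := by
      intro k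
      have h := dirDeriv_congr hΩ₁o (g := fun _ => (0 : ℝ)) (fun z hz => hnormal z hz k) (v, 0)
        hz₀Ω₁
      have hd1 := differentiableAt_of_contDiffOn hΩ (contDiffOn_dirDeriv hΩ hΦ (spaceDir k)) h₀
      have hd2 : DifferentiableAt ℝ (fun z => graphNormal b (Y z)) z₀ :=
        ((contDiff_graphNormal (b := b)).differentiable (by simp) _).comp z₀ (hYd z₀ hz₀Ω₁)
      rw [dirDeriv_inner hd1 hd2, dirDeriv_graphNormal_comp (hYd z₀ hz₀Ω₁), hY₀] at h
      simpa [dirDeriv, hv, graphNormal, hb] using h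
    have hzero : (paramSecondForm (fun p => Φ (p, t₀)) p₀ (N z₀)).vecMul v.ofLp = 0 := by
      ext k
      have h := hcol k
      rw [dirDeriv_mk_zero, sum_inner] at h
      simp only [Matrix.vecMul, dotProduct, paramSecondForm, Matrix.of_apply,
        partialDeriv_partialDeriv_slice hΩ hΦ _ _ h₀]
      simpa [inner_smul_left] using h
    by_contra hne
    have hv0 : v.ofLp ≠ 0 := fun h => hne (by
      have : v = 0 := by ext i; simp [h]
      simp [this])
    have hpos := hpd.dotProduct_mulVec_pos hv0
    rw [Matrix.dotProduct_mulVec, star_trivial, hzero, zero_dotProduct] at hpos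
    exact lt_irrefl _ hpos
  set L₀ := (LinearEquiv.ofInjectiveEndo (fderiv ℝ Ψ z₀ :
    (EuclideanSpace ℝ (Fin n) × ℝ) →ₗ[ℝ] _) hinj).toContinuousLinearEquiv with hL₀
  have hL₀' : HasFDerivAt Ψ (L₀ : (EuclideanSpace ℝ (Fin n) × ℝ) →L[ℝ] _) z₀ := by
    have : (L₀ : (EuclideanSpace ℝ (Fin n) × ℝ) →L[ℝ] _) = fderiv ℝ Ψ z₀ := by
      ext1 <;> rfl
    rw [this]
    exact (hΨd z₀ hz₀Ω₁).differentiableAt.hasFDerivAt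
  have hat₀ : ContDiffAt ℝ ∞ Ψ z₀ := hΨs.contDiffAt (hΩ₁o.mem_nhds hz₀Ω₁)
  have hinf : (∞ : WithTop ℕ∞) ≠ 0 := by simp
  set e := hat₀.toOpenPartialHomeomorph Ψ hL₀' hinf with he
  have hecoe : (e : _ → _) = Ψ := rfl
  -- the inverse is smooth wherever the derivative is invertible, not only at the centre
  set Ω₂ := Ω₁ ∩ fderiv ℝ Ψ ⁻¹' range ((↑) : ((EuclideanSpace ℝ (Fin n) × ℝ) ≃L[ℝ]
    (EuclideanSpace ℝ (Fin n) × ℝ)) → _ →L[ℝ] _) with hΩ₂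
  have hΩ₂o : IsOpen Ω₂ :=
    (hΨs.fderiv_of_isOpen hΩ₁o (m := ∞) (by simp)).continuousOn.isOpen_inter_preimage hΩ₁o
      ContinuousLinearEquiv.isOpen
  have hsrc : z₀ ∈ e.source := hat₀.mem_toOpenPartialHomeomorph_source hL₀' hinf
  have hΨz₀ : Ψ z₀ = (0, t₀) := Prod.ext hY₀ rfl
  have htgt : (0, t₀) ∈ e.target := hΨz₀ ▸ e.map_source hsrc
  have hsymm₀ : e.symm (0, t₀) = z₀ := by rw [← hΨz₀]; exact e.left_inv hsrc
  have hmaps : ∀ z ∈ e.target ∩ e.symm ⁻¹' Ω₂, Ψ (e.symm z) = z := fun z hz => e.right_inv hz.1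
  have hψs : ContDiffOn ℝ ∞ e.symm (e.target ∩ e.symm ⁻¹' Ω₂) := by
    rintro z ⟨hz, hz2, ⟨L, hL⟩⟩
    refine ContDiffAt.contDiffWithinAt (e.contDiffAt_symm (f₀' := L) hz ?_ ?_)
    · rw [hL]
      exact (hΨd _ hz2).differentiableAt.hasFDerivAt
    · exact hΨs.contDiffAt (hΩ₁o.mem_nhds hz2)
  have hopen : IsOpen (e.target ∩ e.symm ⁻¹' Ω₂) :=
    e.symm.continuousOn.isOpen_inter_preimage e.open_target hΩ₂o
  refine ⟨b, e.target ∩ e.symm ⁻¹' Ω₂, e.symm, hopen, ⟨htgt, ?_⟩, hψs,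
    fun z hz => hsub hz.2.1, fun z hz => ?_, hsymm₀, fun z hz => ?_, fun z hz v hv => ?_⟩
  · rw [mem_preimage, hsymm₀]
    exact ⟨hz₀Ω₁, L₀, hL₀'.fderiv.symm⟩
  · exact (congr_arg Prod.snd (hmaps z hz) : (Ψ (e.symm z)).2 = z.2)
  · have h1 : Y (e.symm z) = z.1 := congr_arg Prod.fst (hmaps z hz)
    rw [← h1]
    exact eq_inv_sqrt_smul_graphNormal (hN1 _ (hsub hz.2.1)) hz.2.1.2.2
  · have hid : HasFDerivAt (fun z => Ψ (e.symm z)) (ContinuousLinearMap.id ℝ _) z :=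
      (hasFDerivAt_id z).congr_of_eventuallyEq
        (eventually_of_mem (hopen.mem_nhds hz) fun z hz => hmaps z hz)
    have hcomp := (hΨd _ hz.2.1).differentiableAt.hasFDerivAt.comp z
      (differentiableAt_of_contDiffOn hopen hψs hz).hasFDerivAt
    have := congr_arg (fun L => L (v, (0 : ℝ))) (hid.unique hcomp)
    simp only [ContinuousLinearMap.coe_id', id, ContinuousLinearMap.comp_apply] at this
    rw [show fderiv ℝ e.symm z (v, 0) = 0 from hv, map_zero] at this
    exact congr_arg Prod.fst this

end GaussCoordinates

/-! ### Change of parameters -/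

section Reparametrization

variable {n : ℕ}

/-- The Gauss curvature of a parametrized hypersurface with normal `N`. -/
noncomputable def paramCurvature
    (F : EuclideanSpace ℝ (Fin n) → EuclideanSpace ℝ (Fin (n + 1)))
    (y : EuclideanSpace ℝ (Fin n)) (N : EuclideanSpace ℝ (Fin (n + 1))) : ℝ :=
  ((paramMetric F y)⁻¹ * paramSecondForm F y N).det

/-- The sum of the principal radii of a parametrized hypersurface with normal `N`. -/
noncomputable def paramRadii
    (F : EuclideanSpace ℝ (Fin n) → EuclideanSpace ℝ (Fin (n + 1)))
    (y : EuclideanSpace ℝ (Fin n)) (N : EuclideanSpace ℝ (Fin (n + 1))) : ℝ :=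
  ((paramSecondForm F y N)⁻¹ * paramMetric F y).trace

variable {F G : EuclideanSpace ℝ (Fin n) → EuclideanSpace ℝ (Fin (n + 1))}
  {θ : EuclideanSpace ℝ (Fin n) → EuclideanSpace ℝ (Fin n)} {y : EuclideanSpace ℝ (Fin n)}
  {N : EuclideanSpace ℝ (Fin (n + 1))}

theorem paramMetric_congr (h : F =ᶠ[𝓝 y] G) : paramMetric F y = paramMetric G y := by
  unfold paramMetric partialDeriv
  rw [h.fderiv_eq]

theorem paramSecondForm_congr (h : F =ᶠ[𝓝 y] G) (N : EuclideanSpace ℝ (Fin (n + 1))) :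
    paramSecondForm F y N = paramSecondForm G y N := by
  have h2 : ∀ j, partialDeriv j F =ᶠ[𝓝 y] partialDeriv j G := fun j =>
    h.fderiv.mono fun y' hy' => by rw [partialDeriv, partialDeriv, hy']
  unfold paramSecondForm
  ext i j
  rw [Matrix.of_apply, Matrix.of_apply, partialDeriv, partialDeriv, (h2 j).fderiv_eq]

theorem eq_sum_single (v : EuclideanSpace ℝ (Fin n)) :
    v = ∑ k, v k • EuclideanSpace.single k (1 : ℝ) := by
  ext i
  simp [Finset.sum_apply, Pi.single_apply]

theorem fderiv_apply_eq_sum (v : EuclideanSpace ℝ (Fin n)) :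
    fderiv ℝ F y v = ∑ k, v k • partialDeriv k F y := by
  conv_lhs => rw [eq_sum_single v]
  simp [partialDeriv]

/-- The matrix of the derivative of a change of parameters. -/
noncomputable def jacobian (θ : EuclideanSpace ℝ (Fin n) → EuclideanSpace ℝ (Fin n))
    (y : EuclideanSpace ℝ (Fin n)) : Matrix (Fin n) (Fin n) ℝ :=
  Matrix.of fun i j => fderiv ℝ θ y (EuclideanSpace.single j 1) i

theorem isUnit_jacobian (h : ∀ v, fderiv ℝ θ y v = 0 → v = 0) : IsUnit (jacobian θ y) := by
  rw [Matrix.isUnit_iff_isUnit_det, isUnit_iff_ne_zero]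
  intro hdet
  obtain ⟨v, hv0, hv⟩ := Matrix.exists_mulVec_eq_zero_iff.2 hdet
  refine hv0 ?_
  have : fderiv ℝ θ y (WithLp.toLp 2 v) = 0 := by
    rw [eq_sum_single (WithLp.toLp 2 v), map_sum]
    ext i
    have := congr_fun hv i
    simpa [Matrix.mulVec, dotProduct, jacobian, mul_comm] using this
  simpa using h _ this

theorem partialDeriv_comp (hF : DifferentiableAt ℝ F (θ y)) (hθ : DifferentiableAt ℝ θ y)
    (i : Fin n) : partialDeriv i (F ∘ θ) y =
      fderiv ℝ F (θ y) (fderiv ℝ θ y (EuclideanSpace.single i 1)) := by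
  rw [partialDeriv, fderiv_comp y hF hθ]
  rfl

theorem paramMetric_comp (hF : DifferentiableAt ℝ F (θ y)) (hθ : DifferentiableAt ℝ θ y) :
    paramMetric (F ∘ θ) y =
      (jacobian θ y).transpose * paramMetric F (θ y) * jacobian θ y := by
  ext i j
  rw [paramMetric, Matrix.of_apply, partialDeriv_comp hF hθ, partialDeriv_comp hF hθ,
    fderiv_apply_eq_sum, fderiv_apply_eq_sum, sum_inner]
  simp only [inner_sum, inner_smul_left, inner_smul_right, RCLike.conj_to_real, Matrix.mul_apply,
    Matrix.transpose_apply, jacobian, paramMetric, Matrix.of_apply, Finset.sum_mul]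
  rw [Finset.sum_comm]
  exact Finset.sum_congr rfl fun k _ => Finset.sum_congr rfl fun l _ => by ring

theorem partialDeriv_partialDeriv (hF : ContDiffAt ℝ 2 F y) (k l : Fin n) :
    partialDeriv k (partialDeriv l F) y =
      fderiv ℝ (fderiv ℝ F) y (EuclideanSpace.single k 1) (EuclideanSpace.single l 1) := by
  unfold partialDeriv
  rw [fderiv_clm_apply ((hF.fderiv_right (m := 1) (by norm_num)).differentiableAt (by simp))
    (differentiableAt_const _)]
  simp

theorem paramSecondForm_isHermitian (hF : ContDiffAt ℝ 2 F y) :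
    (paramSecondForm F y N).IsHermitian := by
  ext i j
  rw [Matrix.conjTranspose_apply, star_trivial, paramSecondForm, Matrix.of_apply, Matrix.of_apply,
    partialDeriv_partialDeriv hF, partialDeriv_partialDeriv hF,
    (hF.isSymmSndFDerivAt (by simp)).eq]

/-- The second fundamental form is a tensor: the second derivatives of the change of parameters
contribute only a tangential vector. -/
theorem paramSecondForm_comp (hF : ContDiffAt ℝ 2 F (θ y)) (hθ : ContDiffAt ℝ 2 θ y)
    (hN : ∀ v, inner ℝ (fderiv ℝ F (θ y) v) N = 0) :
    paramSecondForm (F ∘ θ) y N =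
      (jacobian θ y).transpose * paramSecondForm F (θ y) N * jacobian θ y := by
  have hFd : ∀ᶠ x in 𝓝 (θ y), DifferentiableAt ℝ F x :=
    (hF.eventually (by simp)).mono fun x hx => hx.differentiableAt (by simp)
  have hθd : ∀ᶠ x in 𝓝 y, DifferentiableAt ℝ θ x :=
    (hθ.eventually (by simp)).mono fun x hx => hx.differentiableAt (by simp)
  have hF2 : DifferentiableAt ℝ (fderiv ℝ F) (θ y) :=
    (hF.fderiv_right (m := 1) (by norm_num)).differentiableAt (by simp)
  have hθ2 : DifferentiableAt ℝ (fderiv ℝ θ) y :=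
    (hθ.fderiv_right (m := 1) (by norm_num)).differentiableAt (by simp)
  have hθy : DifferentiableAt ℝ θ y := hθd.self_of_nhds
  have hfirst : ∀ j, partialDeriv j (F ∘ θ) =ᶠ[𝓝 y] fun x =>
      (fderiv ℝ F ∘ θ) x (fderiv ℝ θ x (EuclideanSpace.single j 1)) := by
    intro j
    filter_upwards [hθd, hθ.continuousAt.eventually hFd] with x hx hx'
    exact partialDeriv_comp hx' hx j
  have hsecond := fun k l => partialDeriv_partialDeriv hF k l
  have hcomp : ∀ i j, inner ℝ (partialDeriv i (partialDeriv j (F ∘ θ)) y) N =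
      inner ℝ (fderiv ℝ (fderiv ℝ F) (θ y) (fderiv ℝ θ y (EuclideanSpace.single i 1))
        (fderiv ℝ θ y (EuclideanSpace.single j 1))) N := by
    intro i j
    rw [partialDeriv, (hfirst j).fderiv_eq, fderiv_clm_apply (hF2.comp y hθy)
      (hθ2.clm_apply (differentiableAt_const _)), fderiv_comp y hF2 hθy]
    simp only [add_apply, ContinuousLinearMap.comp_apply, Function.comp_apply,
      ContinuousLinearMap.flip_apply, inner_add_left, hN, zero_add]
  ext i j
  rw [paramSecondForm, Matrix.of_apply, hcomp,
    eq_sum_single (fderiv ℝ θ y (EuclideanSpace.single i 1)),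
    eq_sum_single (fderiv ℝ θ y (EuclideanSpace.single j 1))]
  simp only [map_sum, map_smul, sum_apply, smul_apply, sum_inner,
    inner_smul_left, RCLike.conj_to_real, Matrix.mul_apply, Finset.smul_sum,
    Matrix.transpose_apply, jacobian, paramSecondForm, Matrix.of_apply, Finset.sum_mul, hsecond,
    ← Finset.sum_neg_distrib]
  exact Finset.sum_congr rfl fun k _ => Finset.sum_congr rfl fun l _ => by ring

theorem paramSecondForm_comp_posDef_iff (hF : ContDiffAt ℝ 2 F (θ y)) (hθ : ContDiffAt ℝ 2 θ y)
    (hN : ∀ v, inner ℝ (fderiv ℝ F (θ y) v) N = 0) (hinj : ∀ v, fderiv ℝ θ y v = 0 → v = 0) :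
    (paramSecondForm (F ∘ θ) y N).PosDef ↔ (paramSecondForm F (θ y) N).PosDef := by
  rw [paramSecondForm_comp hF hθ hN, ← Matrix.conjTranspose_eq_transpose_of_trivial]
  exact Matrix.IsUnit.posDef_star_left_conjugate_iff (isUnit_jacobian hinj)

theorem paramCurvature_comp (hF : ContDiffAt ℝ 2 F (θ y)) (hθ : ContDiffAt ℝ 2 θ y)
    (hN : ∀ v, inner ℝ (fderiv ℝ F (θ y) v) N = 0) (hinj : ∀ v, fderiv ℝ θ y v = 0 → v = 0) :
    paramCurvature (F ∘ θ) y N = paramCurvature F (θ y) N := by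
  have hL : (jacobian θ y).det ≠ 0 :=
    ((Matrix.isUnit_iff_isUnit_det _).1 (isUnit_jacobian hinj)).ne_zero
  unfold paramCurvature
  rw [paramSecondForm_comp hF hθ hN,
    paramMetric_comp (hF.differentiableAt (by simp)) (hθ.differentiableAt (by simp))]
  simp only [Matrix.det_mul, Matrix.det_nonsing_inv, Matrix.det_transpose, Ring.inverse_eq_inv',
    mul_inv]
  field_simp

theorem paramRadii_comp (hF : ContDiffAt ℝ 2 F (θ y)) (hθ : ContDiffAt ℝ 2 θ y)
    (hN : ∀ v, inner ℝ (fderiv ℝ F (θ y) v) N = 0) (hinj : ∀ v, fderiv ℝ θ y v = 0 → v = 0) :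
    paramRadii (F ∘ θ) y N = paramRadii F (θ y) N := by
  have hL : IsUnit (jacobian θ y).det :=
    (Matrix.isUnit_iff_isUnit_det _).1 (isUnit_jacobian hinj)
  have hLt : IsUnit (jacobian θ y).transpose.det := by rwa [Matrix.det_transpose]
  unfold paramRadii
  rw [paramSecondForm_comp hF hθ hN,
    paramMetric_comp (hF.differentiableAt (by simp)) (hθ.differentiableAt (by simp)),
    Matrix.mul_inv_rev, Matrix.mul_inv_rev]
  set L := jacobian θ y
  have : L⁻¹ * ((paramSecondForm F (θ y) N)⁻¹ * L.transpose⁻¹) *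
      (L.transpose * paramMetric F (θ y) * L) =
      L⁻¹ * ((paramSecondForm F (θ y) N)⁻¹ * paramMetric F (θ y) * L) := by
    simp only [Matrix.mul_assoc]
    rw [← Matrix.mul_assoc L.transpose⁻¹ L.transpose, Matrix.nonsing_inv_mul _ hLt, Matrix.one_mul]
  rw [this, Matrix.trace_mul_comm, Matrix.mul_assoc, Matrix.mul_nonsing_inv _ hL, Matrix.mul_one]

end Reparametrization

/-! ### The sum of the principal radii has no interior maximum -/

section LocalFlow

variable {n : ℕ} {Ω : Set (EuclideanSpace ℝ (Fin n) × ℝ)}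
  {Φ N : EuclideanSpace ℝ (Fin n) × ℝ → EuclideanSpace ℝ (Fin (n + 1))}

/-- Along a locally strictly convex solution of the flow, the sum of the principal radii does not
attain its maximum over earlier times at an interior point of space-time. -/
theorem not_isMax_paramRadii (hn : 1 ≤ n) {α : ℝ} (hα : 0 < α) (hΩ : IsOpen Ω)
    (hΦ : ContDiffOn ℝ ∞ Φ Ω) (hNc : ContinuousOn N Ω) (hN1 : ∀ z ∈ Ω, ‖N z‖ = 1)
    (hNt : ∀ z ∈ Ω, ∀ k, inner ℝ (dirDeriv (spaceDir k) Φ z) (N z) = 0)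
    (himm : ∀ z ∈ Ω, ∀ v : EuclideanSpace ℝ (Fin n), dirDeriv (v, 0) Φ z = 0 → v = 0)
    {p₀ : EuclideanSpace ℝ (Fin n)} {t₀ : ℝ} (h₀ : (p₀, t₀) ∈ Ω)
    (hpd : ∀ z ∈ Ω, (paramSecondForm (fun p => Φ (p, z.2)) z.1 (N z)).PosDef)
    (hflow : ∀ z ∈ Ω, dirDeriv (0, 1) Φ z =
      -(paramCurvature (fun p => Φ (p, z.2)) z.1 (N z) ^ α) • N z)
    (hmax : ∀ z ∈ Ω, z.2 ≤ t₀ → paramRadii (fun p => Φ (p, z.2)) z.1 (N z) ≤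
      paramRadii (fun p => Φ (p, t₀)) p₀ (N (p₀, t₀))) : False := by
  obtain ⟨b, Ω', ψ, hΩ', h₀', hψ, hmaps, hψ2, hψ₀, hNψ, hψinj⟩ :=
    exists_gaussCoordinates hΩ hΦ hNc hN1 hNt himm h₀ (hpd _ h₀)
  set Φ' := Φ ∘ ψ with hΦ'def
  have hΦ' : ContDiffOn ℝ ∞ Φ' Ω' := hΦ.comp hψ hmaps
  have hψd : ∀ z ∈ Ω', DifferentiableAt ℝ ψ z := fun z hz =>
    differentiableAt_of_contDiffOn hΩ' hψ hz
  have hΦd : ∀ z ∈ Ω, DifferentiableAt ℝ Φ z := fun z hz =>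
    differentiableAt_of_contDiffOn hΩ hΦ hz
  have hsnd : ∀ z ∈ Ω', ∀ v, (dirDeriv v ψ z).2 = v.2 := by
    intro z hz v
    have h1 := dirDeriv_congr hΩ' (fun z hz => hψ2 z hz :
      EqOn (fun z => (ψ z).2) (fun z => z.2) Ω') v hz
    have h2 : dirDeriv v (fun z => (ψ z).2) z = (dirDeriv v ψ z).2 := by
      unfold dirDeriv
      rw [((hψd z hz).hasFDerivAt.snd).fderiv]
      rfl
    rw [← h2, h1]
    simp [dirDeriv, fderiv_snd]
  have hchain : ∀ z ∈ Ω', ∀ v, dirDeriv v Φ' z = fderiv ℝ Φ (ψ z) (dirDeriv v ψ z) := by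
    intro z hz v
    rw [hΦ'def, dirDeriv, fderiv_comp z (hΦd _ (hmaps hz)) (hψd z hz)]
    rfl
  have htan : ∀ z ∈ Ω, ∀ v : EuclideanSpace ℝ (Fin n), inner ℝ (fderiv ℝ Φ z (v, 0)) (N z) = 0 := by
    intro z hz v
    change inner ℝ (dirDeriv (v, 0) Φ z) (N z) = 0
    rw [dirDeriv_mk_zero, sum_inner]
    simp [inner_smul_left, hNt z hz]
  have hw : ∀ z : EuclideanSpace ℝ (Fin n) × ℝ, 0 < 1 + ‖z.1‖ ^ 2 := fun z => by positivity
  have hgraph : ∀ z ∈ Ω', graphNormal b z.1 = √(1 + ‖z.1‖ ^ 2) • N (ψ z) := by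
    intro z hz
    rw [hNψ z hz, smul_smul, mul_inv_cancel₀ (Real.sqrt_pos.2 (hw z)).ne', one_smul]
  have hnormal : ∀ z ∈ Ω', ∀ k, inner ℝ (dirDeriv (spaceDir k) Φ' z) (graphNormal b z.1) = 0 := by
    intro z hz k
    have h2 : dirDeriv (spaceDir k) ψ z = ((dirDeriv (spaceDir k) ψ z).1, 0) :=
      Prod.ext rfl (hsnd z hz _)
    rw [hgraph z hz, inner_smul_right, hchain z hz, h2, htan _ (hmaps hz), mul_zero]
  set u := legendre b Φ' with hu
  have hus : ContDiffOn ℝ ∞ u Ω' := contDiffOn_legendre hΦ'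
  -- the slice of `Φ'` at a fixed time is a reparametrization of the slice of `Φ`
  have hslice : ∀ z ∈ Ω', ∃ θ : EuclideanSpace ℝ (Fin n) → EuclideanSpace ℝ (Fin n),
      θ z.1 = (ψ z).1 ∧ ContDiffAt ℝ 2 θ z.1 ∧ (∀ v, fderiv ℝ θ z.1 v = 0 → v = 0) ∧
      (fun y => Φ' (y, z.2)) =ᶠ[𝓝 z.1] (fun p => Φ (p, z.2)) ∘ θ := by
    intro z hz
    have hline : Continuous fun y : EuclideanSpace ℝ (Fin n) => (y, z.2) := by fun_prop
    have hcd : ContDiffAt ℝ 2 ψ (z.1, z.2) :=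
      (hψ.contDiffAt (hΩ'.mem_nhds hz)).of_le ENat.LEInfty.out
    refine ⟨fun y => (ψ (y, z.2)).1, rfl, ?_, fun v hv => hψinj z hz v ?_, ?_⟩
    · exact contDiffAt_fst.comp z.1 (hcd.comp z.1 (by fun_prop))
    · have h1 := (hasFDerivAt_slice (y := z.1) (t := z.2) (hψd z hz)).fst.fderiv
      rw [h1] at hv
      refine Prod.ext ?_ (hsnd z hz _)
      simpa [dirDeriv] using hv
    · have : ∀ᶠ y in 𝓝 z.1, (y, z.2) ∈ Ω' := hline.continuousAt.eventually (hΩ'.mem_nhds hz)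
      filter_upwards [this] with y hy
      simp only [hΦ'def, Function.comp_apply]
      congr 1
      exact Prod.ext rfl (hψ2 _ hy)
  have hFs : ∀ z ∈ Ω', ContDiffAt ℝ 2 (fun p => Φ (p, z.2)) (ψ z).1 := by
    intro z hz
    have h1 : (((ψ z).1, z.2) : EuclideanSpace ℝ (Fin n) × ℝ) = ψ z := Prod.ext rfl (hψ2 z hz).symm
    have h2 : ContDiffAt ℝ 2 Φ ((ψ z).1, z.2) := by
      rw [h1]
      exact (hΦ.contDiffAt (hΩ.mem_nhds (hmaps hz))).of_le ENat.LEInfty.out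
    exact h2.comp (ψ z).1 (by fun_prop)
  have hFt : ∀ z ∈ Ω', ∀ v, inner ℝ (fderiv ℝ (fun p => Φ (p, z.2)) (ψ z).1 v) (N (ψ z)) = 0 := by
    intro z hz v
    have h1 : (((ψ z).1, z.2) : EuclideanSpace ℝ (Fin n) × ℝ) = ψ z := Prod.ext rfl (hψ2 z hz).symm
    have h2 := (hasFDerivAt_slice (f := Φ) (y := (ψ z).1) (t := z.2)
      (by rw [h1]; exact hΦd _ (hmaps hz))).fderiv
    rw [h2, h1]
    simpa using htan _ (hmaps hz) v
  have hII : ∀ z ∈ Ω', paramSecondForm (fun y => Φ' (y, z.2)) z.1 (N (ψ z)) =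
      (√(1 + ‖z.1‖ ^ 2))⁻¹ • spaceHessian u z := by
    intro z hz
    rw [hNψ z hz]
    exact paramSecondForm_eq hΩ' hΦ' hnormal (y := z.1) (t := z.2) hz _
  have hI : ∀ z ∈ Ω', paramMetric (fun y => Φ' (y, z.2)) z.1 = spaceHessian u z *
      (1 + Matrix.vecMulVec z.1.ofLp z.1.ofLp) * spaceHessian u z := fun z hz =>
    paramMetric_eq hΩ' hΦ' hnormal (y := z.1) (t := z.2) hz
  have hA : ∀ z ∈ Ω', (spaceHessian u z).PosDef := by
    intro z hz
    obtain ⟨θ, hθ0, hθ2, hθinj, hθeq⟩ := hslice z hz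
    have h1 := hpd _ (hmaps hz)
    rw [hψ2 z hz, ← hθ0, ← paramSecondForm_comp_posDef_iff (by rw [hθ0]; exact hFs z hz) hθ2
      (by rw [hθ0]; exact hFt z hz) hθinj, ← paramSecondForm_congr hθeq, hII z hz] at h1
    have h2 := h1.smul (Real.sqrt_pos.2 (hw z))
    rwa [smul_smul, mul_inv_cancel₀ (Real.sqrt_pos.2 (hw z)).ne', one_smul] at h2
  have hR : ∀ z ∈ Ω', paramRadii (fun p => Φ (p, (ψ z).2)) (ψ z).1 (N (ψ z)) =
      √(1 + ‖z.1‖ ^ 2) * ((spaceHessian u z).trace +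
        z.1.ofLp ⬝ᵥ (spaceHessian u z).mulVec z.1.ofLp) := by
    intro z hz
    obtain ⟨θ, hθ0, hθ2, hθinj, hθeq⟩ := hslice z hz
    rw [hψ2 z hz, ← hθ0, ← paramRadii_comp (by rw [hθ0]; exact hFs z hz) hθ2
      (by rw [hθ0]; exact hFt z hz) hθinj, paramRadii, ← paramSecondForm_congr hθeq,
      ← paramMetric_congr hθeq, hII z hz, hI z hz, trace_inv_mul_of_legendre (hA z hz)]
  have hK : ∀ z ∈ Ω', paramCurvature (fun p => Φ (p, (ψ z).2)) (ψ z).1 (N (ψ z)) =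
      ((1 + ‖z.1‖ ^ 2) ^ (((n : ℝ) + 2) / 2) * (spaceHessian u z).det)⁻¹ := by
    intro z hz
    obtain ⟨θ, hθ0, hθ2, hθinj, hθeq⟩ := hslice z hz
    rw [hψ2 z hz, ← hθ0, ← paramCurvature_comp (by rw [hθ0]; exact hFs z hz) hθ2
      (by rw [hθ0]; exact hFt z hz) hθinj, paramCurvature, ← paramSecondForm_congr hθeq,
      ← paramMetric_congr hθeq, hII z hz, hI z hz, det_inv_mul_of_legendre (hA z hz)]
  refine not_isMax_sumRadii_of_legendre hn hα hΩ' h₀' hus hA (fun z hz => ?_) fun z hz ht => ?_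
  · have hd := (hA z hz).det_pos
    have hsplit : dirDeriv (0, 1) ψ z = ((dirDeriv (0, 1) ψ z).1, 0) + (0, 1) :=
      Prod.ext (by simp) (by simpa using hsnd z hz _)
    have h1 : dirDeriv (0, 1) u z = inner ℝ (dirDeriv (0, 1) Φ' z) (graphNormal b z.1) := by
      rw [hu, dirDeriv_legendre hΩ' hΦ' hz]
      simp
    have h2 : fderiv ℝ Φ (ψ z) (0, 1) = _ := hflow _ (hmaps hz)
    rw [h1, hgraph z hz, inner_smul_right, hchain z hz, hsplit, map_add, inner_add_left,
      htan _ (hmaps hz), zero_add, h2, inner_smul_left, real_inner_self_eq_norm_sq,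
      hN1 _ (hmaps hz), hK z hz, Real.inv_rpow (by positivity), Real.mul_rpow (by positivity) hd.le,
      ← Real.rpow_mul (hw z).le, Real.sqrt_eq_rpow, Real.rpow_neg hd.le,
      show (1 - α * ((n : ℝ) + 2)) / 2 = 1 / 2 - ((n : ℝ) + 2) / 2 * α by ring,
      Real.rpow_sub (hw z)]
    simp only [RCLike.conj_to_real]
    field_simp
  · have h1 := hmax _ (hmaps hz) (by rw [hψ2 z hz]; exact ht)
    rw [hR z hz] at h1
    have h2 := hR _ h₀'
    rw [hψ₀] at h2
    refine h1.trans (h2.trans ?_).le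
    simp

end LocalFlow

/-! ### Independence of the chart -/

section Charts

variable {n : ℕ} {M : Type*} [TopologicalSpace M] [ChartedSpace (EuclideanSpace ℝ (Fin n)) M]

theorem sumRadii_eq_paramRadii {f ν : M → EuclideanSpace ℝ (Fin (n + 1))} (x : M) :
    sumRadii f ν x = paramRadii (localParam f x)
      (extChartAt 𝓘(ℝ, EuclideanSpace ℝ (Fin n)) x x) (ν x) := by
  rw [sumRadii, paramRadii, Matrix.trace]
  refine Finset.sum_congr rfl fun i _ => ?_
  rw [Matrix.diag, Matrix.mul_apply]
  refine Finset.sum_congr rfl fun j _ => ?_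
  congr 1
  simp only [metric, paramMetric, Matrix.of_apply]
  exact real_inner_comm _ _

variable [IsManifold 𝓘(ℝ, EuclideanSpace ℝ (Fin n)) ∞ M]
  {f : M → EuclideanSpace ℝ (Fin (n + 1))} {c x : M}

theorem contDiffAt_localParam
    (hf : ContMDiff 𝓘(ℝ, EuclideanSpace ℝ (Fin n)) 𝓘(ℝ, EuclideanSpace ℝ (Fin (n + 1))) ∞ f)
    {p : EuclideanSpace ℝ (Fin n)}
    (hp : p ∈ (extChartAt 𝓘(ℝ, EuclideanSpace ℝ (Fin n)) c).target) :
    ContDiffAt ℝ ∞ (localParam f c) p := by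
  rw [← contMDiffAt_iff_contDiffAt]
  exact (hf _).comp p ((contMDiffOn_extChartAt_symm c).contMDiffAt
    ((isOpen_extChartAt_target c).mem_nhds hp))

theorem exists_fderiv_localParam_eq
    (hf : ContMDiff 𝓘(ℝ, EuclideanSpace ℝ (Fin n)) 𝓘(ℝ, EuclideanSpace ℝ (Fin (n + 1))) ∞ f)
    (hx : x ∈ (extChartAt 𝓘(ℝ, EuclideanSpace ℝ (Fin n)) c).source) :
    ∃ L : EuclideanSpace ℝ (Fin n) →
        TangentSpace 𝓘(ℝ, EuclideanSpace ℝ (Fin n)) x, (∀ v, L v = 0 → v = 0) ∧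
      ∀ v, fderiv ℝ (localParam f c) (extChartAt 𝓘(ℝ, EuclideanSpace ℝ (Fin n)) c x) v =
        mfderiv 𝓘(ℝ, EuclideanSpace ℝ (Fin n)) 𝓘(ℝ, EuclideanSpace ℝ (Fin (n + 1))) f x (L v) := by
  have : IsManifold 𝓘(ℝ, EuclideanSpace ℝ (Fin n)) 1 M := IsManifold.of_le (n := ∞) (by simp)
  set p := extChartAt 𝓘(ℝ, EuclideanSpace ℝ (Fin n)) c x with hp
  have hpt : p ∈ (extChartAt 𝓘(ℝ, EuclideanSpace ℝ (Fin n)) c).target :=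
    (extChartAt _ c).map_source hx
  have hpx : (extChartAt 𝓘(ℝ, EuclideanSpace ℝ (Fin n)) c).symm p = x :=
    (extChartAt _ c).left_inv hx
  have hinv := isInvertible_mfderivWithin_extChartAt_symm hpt
  have hd := mdifferentiableWithinAt_extChartAt_symm hpt
  simp only [modelWithCornersSelf_coe, range_id, mfderivWithin_univ, mdifferentiableWithinAt_univ]
    at hinv hd
  have hfd := (hf.mdifferentiable (by simp)) ((extChartAt 𝓘(ℝ, EuclideanSpace ℝ (Fin n)) c).symm p)
  have hcomp := mfderiv_comp p hfd hd
  rw [mfderiv_eq_fderiv] at hcomp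
  refine ⟨fun v => hpx ▸ mfderiv 𝓘(ℝ, EuclideanSpace ℝ (Fin n)) 𝓘(ℝ, EuclideanSpace ℝ (Fin n))
    (extChartAt 𝓘(ℝ, EuclideanSpace ℝ (Fin n)) c).symm p v, fun v hv => ?_, fun v => ?_⟩
  · revert hv
    clear_value p
    subst hpx
    intro hv
    exact hinv.injective (hv.trans (map_zero _).symm)
  · change fderiv ℝ (f ∘ (extChartAt 𝓘(ℝ, EuclideanSpace ℝ (Fin n)) c).symm) p v = _
    rw [hcomp]
    clear_value p
    subst hpx
    rfl

/-- In any chart around `x`, the parametrization of an immersed hypersurface is an immersion, its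
tangent vectors are normal to the normal, and the geometric quantities at `x` can be computed. -/
theorem geometry_in_chart
    (hf : ContMDiff 𝓘(ℝ, EuclideanSpace ℝ (Fin n)) 𝓘(ℝ, EuclideanSpace ℝ (Fin (n + 1))) ∞ f)
    {ν : M → EuclideanSpace ℝ (Fin (n + 1))}
    (himm : ∀ x, Function.Injective (mfderiv 𝓘(ℝ, EuclideanSpace ℝ (Fin n))
      𝓘(ℝ, EuclideanSpace ℝ (Fin (n + 1))) f x))
    (hν : IsOutwardUnitNormal f ν)
    (hx : x ∈ (extChartAt 𝓘(ℝ, EuclideanSpace ℝ (Fin n)) c).source) :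
    (∀ v, fderiv ℝ (localParam f c) (extChartAt 𝓘(ℝ, EuclideanSpace ℝ (Fin n)) c x) v = 0 →
      v = 0) ∧
    (∀ v, inner ℝ (fderiv ℝ (localParam f c)
      (extChartAt 𝓘(ℝ, EuclideanSpace ℝ (Fin n)) c x) v) (ν x) = 0) ∧
    sumRadii f ν x = paramRadii (localParam f c)
      (extChartAt 𝓘(ℝ, EuclideanSpace ℝ (Fin n)) c x) (ν x) ∧
    gaussCurvature f ν x = paramCurvature (localParam f c)
      (extChartAt 𝓘(ℝ, EuclideanSpace ℝ (Fin n)) c x) (ν x) ∧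
    ((secondForm f ν x).PosDef ↔ (paramSecondForm (localParam f c)
      (extChartAt 𝓘(ℝ, EuclideanSpace ℝ (Fin n)) c x) (ν x)).PosDef) := by
  have general : ∀ c, x ∈ (extChartAt 𝓘(ℝ, EuclideanSpace ℝ (Fin n)) c).source →
      (∀ v, fderiv ℝ (localParam f c) (extChartAt 𝓘(ℝ, EuclideanSpace ℝ (Fin n)) c x) v = 0 →
        v = 0) ∧
      (∀ v, inner ℝ (fderiv ℝ (localParam f c)
        (extChartAt 𝓘(ℝ, EuclideanSpace ℝ (Fin n)) c x) v) (ν x) = 0) := by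
    intro c hc
    obtain ⟨L, hL0, hL⟩ := exists_fderiv_localParam_eq hf hc
    refine ⟨fun v hv => hL0 v (himm x ?_), fun v => ?_⟩
    · rw [← hL, hv]
      exact (map_zero _).symm
    · rw [hL]
      exact (real_inner_comm _ _).trans (hν.normal x (L v))
  obtain ⟨himmc, hnc⟩ := general c hx
  have hxx := mem_extChartAt_source (I := 𝓘(ℝ, EuclideanSpace ℝ (Fin n))) x
  obtain ⟨himmx, hnx⟩ := general x hxx
  refine ⟨himmc, hnc, ?_⟩
  set φ := extChartAt 𝓘(ℝ, EuclideanSpace ℝ (Fin n)) c with hφ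
  set φ' := extChartAt 𝓘(ℝ, EuclideanSpace ℝ (Fin n)) x with hφ'
  set θ : EuclideanSpace ℝ (Fin n) → EuclideanSpace ℝ (Fin n) := φ' ∘ φ.symm with hθ
  have hpt : φ x ∈ φ.target := φ.map_source hx
  have hθx : θ (φ x) = φ' x := by simp only [hθ, Function.comp_apply, φ.left_inv hx]
  have hsymm : ContMDiffAt 𝓘(ℝ, EuclideanSpace ℝ (Fin n)) 𝓘(ℝ, EuclideanSpace ℝ (Fin n)) ∞
      φ.symm (φ x) :=
    (contMDiffOn_extChartAt_symm c).contMDiffAt ((isOpen_extChartAt_target c).mem_nhds hpt)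
  have hθs : ContDiffAt ℝ ∞ θ (φ x) := by
    rw [← contMDiffAt_iff_contDiffAt]
    refine ContMDiffAt.comp (φ x) ?_ hsymm
    rw [φ.left_inv hx]
    exact contMDiffAt_extChartAt
  have heq : localParam f c =ᶠ[𝓝 (φ x)] localParam f x ∘ θ := by
    have : ∀ᶠ p in 𝓝 (φ x), φ.symm p ∈ φ'.source := by
      refine hsymm.continuousAt.eventually ?_
      rw [φ.left_inv hx]
      exact extChartAt_source_mem_nhds x
    filter_upwards [this] with p hp
    simp only [localParam, hθ, Function.comp_apply]
    rw [← hφ', φ'.left_inv hp]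
  have hθ2 : ContDiffAt ℝ 2 θ (φ x) := hθs.of_le ENat.LEInfty.out
  have hF2 : ContDiffAt ℝ 2 (localParam f x) (θ (φ x)) := by
    rw [hθx]
    exact (contDiffAt_localParam hf (mem_extChartAt_target x)).of_le ENat.LEInfty.out
  have hN : ∀ v, inner ℝ (fderiv ℝ (localParam f x) (θ (φ x)) v) (ν x) = 0 := by
    rw [hθx]
    exact hnx
  have hinj : ∀ v, fderiv ℝ θ (φ x) v = 0 → v = 0 := by
    intro v hv
    refine himmc v ?_
    rw [heq.fderiv_eq, fderiv_comp _ (hF2.differentiableAt (by simp))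
      (hθ2.differentiableAt (by simp)), ContinuousLinearMap.comp_apply, hv, map_zero]
  refine ⟨?_, ?_, ?_⟩
  · rw [paramRadii, paramSecondForm_congr heq, paramMetric_congr heq, ← paramRadii,
      paramRadii_comp hF2 hθ2 hN hinj, hθx]
    exact sumRadii_eq_paramRadii x
  · rw [paramCurvature, paramSecondForm_congr heq, paramMetric_congr heq, ← paramCurvature,
      paramCurvature_comp hF2 hθ2 hN hinj, hθx]
    rfl
  · rw [paramSecondForm_congr heq, paramSecondForm_comp_posDef_iff hF2 hθ2 hN hinj, hθx]
    rfl

end Charts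

/-! ### Continuity in space-time up to the initial time -/

section SpaceTime

variable {n : ℕ}

theorem hasFDerivAt_slice_of_contDiffOn {F : Type*} [NormedAddCommGroup F] [NormedSpace ℝ F]
    {f : EuclideanSpace ℝ (Fin n) × ℝ → F} {U : Set (EuclideanSpace ℝ (Fin n))} {I : Set ℝ}
    (hU : IsOpen U) (hf : ContDiffOn ℝ ∞ f (U ×ˢ I)) {z : EuclideanSpace ℝ (Fin n) × ℝ}
    (hz : z ∈ U ×ˢ I) :
    HasFDerivAt (fun p => f (p, z.2)) ((fderivWithin ℝ f (U ×ˢ I) z).comp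
      (ContinuousLinearMap.inl ℝ (EuclideanSpace ℝ (Fin n)) ℝ)) z.1 := by
  have h1 : HasFDerivWithinAt f (fderivWithin ℝ f (U ×ˢ I) z) (U ×ˢ I) (z.1, z.2) :=
    ((hf.differentiableOn (by simp)) z hz).hasFDerivWithinAt
  have h0 : HasFDerivWithinAt (fun p => (p, z.2))
      (ContinuousLinearMap.inl ℝ (EuclideanSpace ℝ (Fin n)) ℝ) U z.1 :=
    (hasFDerivAt_prodMk_left z.1 z.2).hasFDerivWithinAt
  have hmaps : MapsTo (fun p : EuclideanSpace ℝ (Fin n) => (p, z.2)) U (U ×ˢ I) :=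
    fun p hp => ⟨hp, hz.2⟩
  have h2 := h1.comp z.1 h0 hmaps
  exact h2.hasFDerivAt (hU.mem_nhds hz.1)

/-- Spatial derivatives are jointly smooth up to the boundary of the time interval, because they are
values of the derivative within the space-time domain. -/
theorem contDiffOn_partialDeriv_slice
    {Φ : EuclideanSpace ℝ (Fin n) × ℝ → EuclideanSpace ℝ (Fin (n + 1))}
    {U : Set (EuclideanSpace ℝ (Fin n))} {I : Set ℝ} (hU : IsOpen U) (hI : UniqueDiffOn ℝ I)
    (hΦ : ContDiffOn ℝ ∞ Φ (U ×ˢ I)) (k : Fin n) :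
    ContDiffOn ℝ ∞ (fun z => partialDeriv k (fun p => Φ (p, z.2)) z.1) (U ×ˢ I) := by
  have h := (hΦ.fderivWithin (hU.uniqueDiffOn.prod hI) (m := ∞) (by simp)).clm_apply
    (contDiffOn_const (c := ((EuclideanSpace.single k 1 : EuclideanSpace ℝ (Fin n)), (0 : ℝ))))
  refine h.congr fun z hz => ?_
  rw [partialDeriv, (hasFDerivAt_slice_of_contDiffOn hU hΦ hz).fderiv]
  simp

theorem continuousOn_paramMetric
    {Φ : EuclideanSpace ℝ (Fin n) × ℝ → EuclideanSpace ℝ (Fin (n + 1))}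
    {U : Set (EuclideanSpace ℝ (Fin n))} {I : Set ℝ} (hU : IsOpen U) (hI : UniqueDiffOn ℝ I)
    (hΦ : ContDiffOn ℝ ∞ Φ (U ×ˢ I)) :
    ContinuousOn (fun z => paramMetric (fun p => Φ (p, z.2)) z.1) (U ×ˢ I) :=
  continuousOn_pi.2 fun i => continuousOn_pi.2 fun j =>
    (contDiffOn_partialDeriv_slice hU hI hΦ i).continuousOn.inner
      (contDiffOn_partialDeriv_slice hU hI hΦ j).continuousOn

theorem continuousOn_paramSecondForm
    {Φ N : EuclideanSpace ℝ (Fin n) × ℝ → EuclideanSpace ℝ (Fin (n + 1))}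
    {U : Set (EuclideanSpace ℝ (Fin n))} {I : Set ℝ} (hU : IsOpen U) (hI : UniqueDiffOn ℝ I)
    (hΦ : ContDiffOn ℝ ∞ Φ (U ×ˢ I)) (hN : ContinuousOn N (U ×ˢ I)) :
    ContinuousOn (fun z => paramSecondForm (fun p => Φ (p, z.2)) z.1 (N z)) (U ×ˢ I) :=
  continuousOn_pi.2 fun i => continuousOn_pi.2 fun j =>
    ((contDiffOn_partialDeriv_slice hU hI
      (contDiffOn_partialDeriv_slice hU hI hΦ j) i).continuousOn.inner hN).neg

theorem posDef_paramMetric {F : EuclideanSpace ℝ (Fin n) → EuclideanSpace ℝ (Fin (n + 1))}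
    {y : EuclideanSpace ℝ (Fin n)} (h : ∀ v, fderiv ℝ F y v = 0 → v = 0) :
    (paramMetric F y).PosDef := by
  refine Matrix.PosDef.of_dotProduct_mulVec_pos ?_ fun x hx => ?_
  · ext i j
    simp only [Matrix.conjTranspose_apply, star_trivial, paramMetric, Matrix.of_apply]
    exact real_inner_comm _ _
  · have hne : fderiv ℝ F y (WithLp.toLp 2 x) ≠ 0 := fun h0 => hx (by simpa using h _ h0)
    have hpos := real_inner_self_pos.2 hne
    rw [fderiv_apply_eq_sum, sum_inner] at hpos
    simp only [inner_sum, inner_smul_left, inner_smul_right, RCLike.conj_to_real] at hpos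
    simp only [star_trivial, dotProduct, Matrix.mulVec, paramMetric, Matrix.of_apply,
      Finset.mul_sum]
    refine hpos.trans_eq ?_
    exact Finset.sum_congr rfl fun k _ => Finset.sum_congr rfl fun l _ => by ring

end SpaceTime

/-! ### The flow on the manifold -/

section Flow

variable {n : ℕ} {M : Type*} [TopologicalSpace M] [ChartedSpace (EuclideanSpace ℝ (Fin n)) M]

/-- A time-dependent map read in space-time coordinates, the chart being the one around `c`. -/
noncomputable def spaceTimeParam (X : M → ℝ → EuclideanSpace ℝ (Fin (n + 1))) (c : M)
    (z : EuclideanSpace ℝ (Fin n) × ℝ) : EuclideanSpace ℝ (Fin (n + 1)) :=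
  X ((extChartAt 𝓘(ℝ, EuclideanSpace ℝ (Fin n)) c).symm z.1) z.2

variable {α T : ℝ} {X ν : M → ℝ → EuclideanSpace ℝ (Fin (n + 1))}

theorem contMDiff_slice (hX : IsSmoothFlow α T X ν) {t : ℝ} (ht : t ∈ Ico 0 T) :
    ContMDiff 𝓘(ℝ, EuclideanSpace ℝ (Fin n)) 𝓘(ℝ, EuclideanSpace ℝ (Fin (n + 1))) ∞
      fun x => X x t := by
  rw [← contMDiffOn_univ]
  exact hX.smooth.comp (contMDiff_id.prodMk contMDiff_const).contMDiffOn
    fun x _ => ⟨mem_univ _, ht⟩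

theorem continuousOn_spaceTimeParam_normal (hX : IsSmoothFlow α T X ν) (c : M) :
    ContinuousOn (spaceTimeParam ν c)
      ((extChartAt 𝓘(ℝ, EuclideanSpace ℝ (Fin n)) c).target ×ˢ Ico 0 T) := by
  refine hX.continuous_normal.comp
    (f := fun z : EuclideanSpace ℝ (Fin n) × ℝ =>
      ((extChartAt 𝓘(ℝ, EuclideanSpace ℝ (Fin n)) c).symm z.1, z.2)) ?_
    fun z hz => ⟨mem_univ _, hz.2⟩
  exact ((continuousOn_extChartAt_symm c).comp continuousOn_fst fun z hz => hz.1).prodMk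
    continuousOn_snd

theorem eventually_mem_source (c : M) (t : ℝ) :
    ∀ᶠ q : M × ℝ in 𝓝[univ ×ˢ Ico 0 T] (c, t),
      q.1 ∈ (extChartAt 𝓘(ℝ, EuclideanSpace ℝ (Fin n)) c).source :=
  nhdsWithin_le_nhds (continuousAt_fst.eventually (extChartAt_source_mem_nhds c))

theorem tendsto_spaceTime_chart (c : M) (t : ℝ) :
    Tendsto (fun q : M × ℝ => (extChartAt 𝓘(ℝ, EuclideanSpace ℝ (Fin n)) c q.1, q.2))
      (𝓝[univ ×ˢ Ico 0 T] (c, t))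
      (𝓝[(extChartAt 𝓘(ℝ, EuclideanSpace ℝ (Fin n)) c).target ×ˢ Ico 0 T]
        (extChartAt 𝓘(ℝ, EuclideanSpace ℝ (Fin n)) c c, t)) := by
  have hcont : ContinuousAt (fun q : M × ℝ =>
      (extChartAt 𝓘(ℝ, EuclideanSpace ℝ (Fin n)) c q.1, q.2)) (c, t) :=
    ContinuousAt.prodMk (ContinuousAt.comp (f := Prod.fst) (continuousAt_extChartAt c)
      continuousAt_fst) continuousAt_snd
  refine tendsto_nhdsWithin_iff.2 ⟨hcont.mono_left nhdsWithin_le_nhds, ?_⟩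
  have hsrc : ∀ᶠ q : M × ℝ in 𝓝 (c, t),
      q.1 ∈ (extChartAt 𝓘(ℝ, EuclideanSpace ℝ (Fin n)) c).source :=
    continuousAt_fst.eventually (extChartAt_source_mem_nhds c)
  filter_upwards [nhdsWithin_le_nhds hsrc, self_mem_nhdsWithin] with q hq hq'
  exact ⟨(extChartAt _ c).map_source hq, hq'.2⟩

variable [IsManifold 𝓘(ℝ, EuclideanSpace ℝ (Fin n)) ∞ M]

theorem contDiffOn_spaceTimeParam (hX : IsSmoothFlow α T X ν) (c : M) :
    ContDiffOn ℝ ∞ (spaceTimeParam X c)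
      ((extChartAt 𝓘(ℝ, EuclideanSpace ℝ (Fin n)) c).target ×ˢ Ico 0 T) := by
  rw [← contMDiffOn_iff_contDiffOn]
  exact hX.smooth.comp (((contMDiffOn_extChartAt_symm c).comp contDiff_fst.contMDiff.contMDiffOn
    fun z hz => hz.1).prodMk contDiff_snd.contMDiff.contMDiffOn) fun z hz => ⟨mem_univ _, hz.2⟩

/-- The geometric quantities of the flow at `(x, t)`, in a chart that contains `x`. -/
theorem flow_geometry_in_chart (hX : IsSmoothFlow α T X ν) {c : M}
    {z : EuclideanSpace ℝ (Fin n) × ℝ}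
    (hz : z ∈ (extChartAt 𝓘(ℝ, EuclideanSpace ℝ (Fin n)) c).target ×ˢ Ico 0 T) :
    (∀ v, fderiv ℝ (fun p => spaceTimeParam X c (p, z.2)) z.1 v = 0 → v = 0) ∧
    (∀ v, inner ℝ (fderiv ℝ (fun p => spaceTimeParam X c (p, z.2)) z.1 v)
      (spaceTimeParam ν c z) = 0) ∧
    sumRadii (fun y => X y z.2) (fun y => ν y z.2)
        ((extChartAt 𝓘(ℝ, EuclideanSpace ℝ (Fin n)) c).symm z.1) =
      paramRadii (fun p => spaceTimeParam X c (p, z.2)) z.1 (spaceTimeParam ν c z) ∧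
    gaussCurvature (fun y => X y z.2) (fun y => ν y z.2)
        ((extChartAt 𝓘(ℝ, EuclideanSpace ℝ (Fin n)) c).symm z.1) =
      paramCurvature (fun p => spaceTimeParam X c (p, z.2)) z.1 (spaceTimeParam ν c z) ∧
    ((secondForm (fun y => X y z.2) (fun y => ν y z.2)
        ((extChartAt 𝓘(ℝ, EuclideanSpace ℝ (Fin n)) c).symm z.1)).PosDef ↔
      (paramSecondForm (fun p => spaceTimeParam X c (p, z.2)) z.1
        (spaceTimeParam ν c z)).PosDef) := by
  have h := geometry_in_chart (c := c)
    (x := (extChartAt 𝓘(ℝ, EuclideanSpace ℝ (Fin n)) c).symm z.1) (contMDiff_slice hX hz.2)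
    (hX.immersion z.2 hz.2) (hX.outward_normal z.2 hz.2) ((extChartAt _ c).map_target hz.1)
  rw [(extChartAt 𝓘(ℝ, EuclideanSpace ℝ (Fin n)) c).right_inv hz.1] at h
  exact h

theorem isHermitian_paramSecondForm_flow (hX : IsSmoothFlow α T X ν) {c : M}
    {z : EuclideanSpace ℝ (Fin n) × ℝ}
    (hz : z ∈ (extChartAt 𝓘(ℝ, EuclideanSpace ℝ (Fin n)) c).target ×ˢ Ico 0 T) :
    (paramSecondForm (fun p => spaceTimeParam X c (p, z.2)) z.1
      (spaceTimeParam ν c z)).IsHermitian :=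
  paramSecondForm_isHermitian
    ((contDiffAt_localParam (contMDiff_slice hX hz.2) hz.1).of_le ENat.LEInfty.out)

theorem continuousOn_metric_flow (hX : IsSmoothFlow α T X ν) (c : M) :
    ContinuousOn (fun z => paramMetric (fun p => spaceTimeParam X c (p, z.2)) z.1)
      ((extChartAt 𝓘(ℝ, EuclideanSpace ℝ (Fin n)) c).target ×ˢ Ico 0 T) :=
  continuousOn_paramMetric (isOpen_extChartAt_target c) (uniqueDiffOn_Ico 0 T)
    (contDiffOn_spaceTimeParam hX c)

theorem continuousOn_secondForm_flow (hX : IsSmoothFlow α T X ν) (c : M) :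
    ContinuousOn (fun z => paramSecondForm (fun p => spaceTimeParam X c (p, z.2)) z.1
      (spaceTimeParam ν c z)) ((extChartAt 𝓘(ℝ, EuclideanSpace ℝ (Fin n)) c).target ×ˢ Ico 0 T) :=
  continuousOn_paramSecondForm (isOpen_extChartAt_target c) (uniqueDiffOn_Ico 0 T)
    (contDiffOn_spaceTimeParam hX c) (continuousOn_spaceTimeParam_normal hX c)

/-- Strict convexity is an open condition in space-time. -/
theorem eventually_posDef_secondForm (hX : IsSmoothFlow α T X ν) {c : M} {t : ℝ}
    (ht : t ∈ Ico 0 T) (h : (secondForm (fun y => X y t) (fun y => ν y t) c).PosDef) :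
    ∀ᶠ q : M × ℝ in 𝓝[univ ×ˢ Ico 0 T] (c, t),
      (secondForm (fun y => X y q.2) (fun y => ν y q.2) q.1).PosDef := by
  set φ := extChartAt 𝓘(ℝ, EuclideanSpace ℝ (Fin n)) c with hφ
  have hz₀ : (φ c, t) ∈ φ.target ×ˢ Ico 0 T := ⟨mem_extChartAt_target c, ht⟩
  have hc : φ.symm (φ c) = c := φ.left_inv (mem_extChartAt_source c)
  have hpd₀ := (flow_geometry_in_chart hX hz₀).2.2.2.2
  simp only [← hφ, hc] at hpd₀
  have hev := eventually_posDef (continuousOn_secondForm_flow hX c) hz₀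
    (fun z hz => isHermitian_paramSecondForm_flow hX (c := c) hz) (hpd₀.1 h)
  filter_upwards [(tendsto_spaceTime_chart (n := n) c t).eventually hev,
    eventually_mem_source (n := n) c t, self_mem_nhdsWithin] with q hq hq1 hq2
  have hz : (φ q.1, q.2) ∈ φ.target ×ˢ Ico 0 T := ⟨φ.map_source hq1, hq2.2⟩
  have h2 := (flow_geometry_in_chart hX hz).2.2.2.2
  simp only [← hφ, φ.left_inv hq1] at h2
  exact h2.2 hq

theorem continuousWithinAt_sumRadii (hX : IsSmoothFlow α T X ν) {c : M} {t : ℝ}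
    (ht : t ∈ Ico 0 T) (h : (secondForm (fun y => X y t) (fun y => ν y t) c).PosDef) :
    ContinuousWithinAt (fun q : M × ℝ => sumRadii (fun y => X y q.2) (fun y => ν y q.2) q.1)
      (univ ×ˢ Ico 0 T) (c, t) := by
  set φ := extChartAt 𝓘(ℝ, EuclideanSpace ℝ (Fin n)) c with hφ
  have hz₀ : (φ c, t) ∈ φ.target ×ˢ Ico 0 T := ⟨mem_extChartAt_target c, ht⟩
  have hc : φ.symm (φ c) = c := φ.left_inv (mem_extChartAt_source c)
  have hgeo := (flow_geometry_in_chart hX hz₀).2.2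
  simp only [← hφ, hc] at hgeo
  have hdet := (hgeo.2.2.1 h).det_pos.ne'
  have hII := continuousOn_secondForm_flow hX c _ hz₀
  have hI := continuousOn_metric_flow hX c _ hz₀
  have hinv : ContinuousWithinAt (fun z => (paramSecondForm (fun p => spaceTimeParam X c (p, z.2))
      z.1 (spaceTimeParam ν c z))⁻¹) (φ.target ×ˢ Ico 0 T) (φ c, t) := by
    simp only [Matrix.inv_def, Ring.inverse_eq_inv']
    exact ((continuous_id.matrix_det.continuousAt.comp_continuousWithinAt hII).inv₀ hdet).smul
      (continuous_id.matrix_adjugate.continuousAt.comp_continuousWithinAt hII)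
  have hR : ContinuousWithinAt (fun z => paramRadii (fun p => spaceTimeParam X c (p, z.2)) z.1
      (spaceTimeParam ν c z)) (φ.target ×ˢ Ico 0 T) (φ c, t) :=
    continuous_id.matrix_trace.continuousAt.comp_continuousWithinAt (hinv.mul hI)
  rw [ContinuousWithinAt, hgeo.1]
  refine (hR.tendsto.comp (tendsto_spaceTime_chart (n := n) c t)).congr' ?_
  filter_upwards [eventually_mem_source (n := n) c t, self_mem_nhdsWithin] with q hq1 hq2
  have hz : (φ q.1, q.2) ∈ φ.target ×ˢ Ico 0 T := ⟨φ.map_source hq1, hq2.2⟩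
  have h2 := (flow_geometry_in_chart hX hz).2.2.1
  simp only [← hφ, φ.left_inv hq1] at h2
  exact h2.symm

/-- As long as the flow is strictly convex, the sum of the principal radii does not attain its
maximum over earlier times at a positive time. -/
theorem not_isMax_sumRadii (hn : 1 ≤ n) (hα : 0 < α) (hX : IsSmoothFlow α T X ν) {t₁ : ℝ}
    (ht₁ : t₁ ≤ T)
    (hconv : ∀ t ∈ Ico 0 t₁, IsStrictlyConvex (fun x => X x t) (fun x => ν x t))
    {x₀ : M} {t₀ : ℝ} (ht₀ : t₀ ∈ Ioo 0 t₁)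
    (hmax : ∀ x, ∀ t ∈ Icc 0 t₀, sumRadii (fun y => X y t) (fun y => ν y t) x ≤
      sumRadii (fun y => X y t₀) (fun y => ν y t₀) x₀) : False := by
  set φ := extChartAt 𝓘(ℝ, EuclideanSpace ℝ (Fin n)) x₀ with hφ
  have hsub : φ.target ×ˢ Ioo 0 t₁ ⊆ φ.target ×ˢ Ico 0 T :=
    prod_mono le_rfl fun t ht => ⟨ht.1.le, ht.2.trans_le ht₁⟩
  have hΩ : IsOpen (φ.target ×ˢ Ioo 0 t₁) := (isOpen_extChartAt_target x₀).prod isOpen_Ioo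
  have hΦ := (contDiffOn_spaceTimeParam hX x₀).mono hsub
  have hslice : ∀ z ∈ φ.target ×ˢ Ioo 0 t₁, ∀ v : EuclideanSpace ℝ (Fin n),
      dirDeriv (v, 0) (spaceTimeParam X x₀) z =
        fderiv ℝ (fun p => spaceTimeParam X x₀ (p, z.2)) z.1 v := by
    intro z hz v
    rw [(hasFDerivAt_slice (y := z.1) (t := z.2) (differentiableAt_of_contDiffOn hΩ hΦ hz)).fderiv]
    simp [dirDeriv]
  have hc : φ.symm (φ x₀) = x₀ := φ.left_inv (mem_extChartAt_source x₀)
  have hz₀ : (φ x₀, t₀) ∈ φ.target ×ˢ Ioo 0 t₁ := ⟨mem_extChartAt_target x₀, ht₀⟩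
  refine not_isMax_paramRadii hn hα hΩ hΦ ((continuousOn_spaceTimeParam_normal hX x₀).mono hsub)
    (fun z hz => (hX.outward_normal z.2 (hsub hz).2).norm_eq_one _)
    (fun z hz k => ?_) (fun z hz v hv => ?_) hz₀
    (fun z hz => ?_) (fun z hz => ?_) (fun z hz hzt => ?_)
  · rw [spaceDir, hslice z hz]
    exact (flow_geometry_in_chart hX (hsub hz)).2.1 _
  · rw [hslice z hz] at hv
    exact (flow_geometry_in_chart hX (hsub hz)).1 v hv
  · exact (flow_geometry_in_chart hX (hsub hz)).2.2.2.2.1 (hconv z.2 ⟨hz.2.1.le, hz.2.2⟩ _)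
  · have hev := (hX.evolution z.2 (hsub hz).2 (φ.symm z.1)).hasDerivAt
      (Ico_mem_nhds hz.2.1 (hsub hz).2.2)
    have hd := (differentiableAt_of_contDiffOn hΩ hΦ hz).hasFDerivAt
    have hline : HasDerivAt (fun s : ℝ => (z.1, s)) ((0 : EuclideanSpace ℝ (Fin n)), (1 : ℝ)) z.2 :=
      (hasDerivAt_const z.2 z.1).prodMk (hasDerivAt_id z.2)
    have hcomp := hd.comp_hasDerivAt z.2 hline
    rw [← (flow_geometry_in_chart hX (hsub hz)).2.2.2.1]
    exact hcomp.unique hev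
  · have h1 := (flow_geometry_in_chart hX (hsub hz)).2.2.1
    have h2 := (flow_geometry_in_chart hX (hsub hz₀)).2.2.1
    simp only [← hφ, hc] at h1 h2
    rw [← h1, ← h2]
    exact hmax _ _ ⟨hz.2.1.le, hzt⟩

/-- The inequality of arithmetic and geometric means for the principal radii. -/
theorem card_mul_curvature_rpow_le_sumRadii (hn : 1 ≤ n) (hX : IsSmoothFlow α T X ν) {t : ℝ}
    (ht : t ∈ Ico 0 T) {x : M} (h : (secondForm (fun y => X y t) (fun y => ν y t) x).PosDef) :
    (metric (fun y => X y t) x).PosDef ∧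
    0 < gaussCurvature (fun y => X y t) (fun y => ν y t) x ∧
    n * gaussCurvature (fun y => X y t) (fun y => ν y t) x ^ (-(1 / (n : ℝ))) ≤
      sumRadii (fun y => X y t) (fun y => ν y t) x := by
  have : Nonempty (Fin n) := ⟨⟨0, hn⟩⟩
  have hgeo := geometry_in_chart (c := x) (contMDiff_slice hX ht) (hX.immersion t ht)
    (hX.outward_normal t ht) (mem_extChartAt_source x)
  have hg : (metric (fun y => X y t) x).PosDef := posDef_paramMetric hgeo.1
  have hK : gaussCurvature (fun y => X y t) (fun y => ν y t) x =
      ((secondForm (fun y => X y t) (fun y => ν y t) x)⁻¹.det *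
        (metric (fun y => X y t) x).det)⁻¹ := by
    rw [gaussCurvature, weingarten, Matrix.det_mul, Matrix.det_nonsing_inv, Matrix.det_nonsing_inv,
      Ring.inverse_eq_inv', mul_inv, inv_inv, mul_comm]
  have hpos : 0 < (secondForm (fun y => X y t) (fun y => ν y t) x)⁻¹.det *
      (metric (fun y => X y t) x).det := mul_pos h.inv.det_pos hg.det_pos
  refine ⟨hg, by rw [hK]; exact inv_pos.2 hpos, ?_⟩
  have hle := card_mul_det_rpow_le_trace h.inv hg
  rw [Fintype.card_fin] at hle
  rw [hK, Real.inv_rpow hpos.le, Real.rpow_neg hpos.le, inv_inv, sumRadii_eq_paramRadii]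
  exact hle

variable [CompactSpace M]

/-- The sum of the principal radii is bounded by its initial values as long as the flow is strictly
convex. -/
theorem sumRadii_le_initial (hn : 1 ≤ n) (hα : 0 < α) (hX : IsSmoothFlow α T X ν) {t₁ : ℝ}
    (ht₁ : t₁ ≤ T)
    (hconv : ∀ t ∈ Ico 0 t₁, IsStrictlyConvex (fun x => X x t) (fun x => ν x t))
    {m : ℝ} (hm : ∀ x, sumRadii (fun y => X y 0) (fun y => ν y 0) x ≤ m) {t : ℝ}
    (ht : t ∈ Ico 0 t₁) (x : M) : sumRadii (fun y => X y t) (fun y => ν y t) x ≤ m := by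
  have hK : IsCompact ((univ : Set M) ×ˢ Icc 0 t) := isCompact_univ.prod isCompact_Icc
  have hsub : (univ : Set M) ×ˢ Icc 0 t ⊆ univ ×ˢ Ico 0 T :=
    prod_mono le_rfl fun s hs => ⟨hs.1, hs.2.trans_lt (ht.2.trans_le ht₁)⟩
  have hcont : ContinuousOn
      (fun q : M × ℝ => sumRadii (fun y => X y q.2) (fun y => ν y q.2) q.1)
      (univ ×ˢ Icc 0 t) := fun q hq =>
    (continuousWithinAt_sumRadii hX (hsub hq).2
      (hconv q.2 ⟨hq.2.1, hq.2.2.trans_lt ht.2⟩ q.1)).mono hsub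
  obtain ⟨q, hq, hqmax⟩ := hK.exists_isMaxOn ⟨(x, t), mem_univ _, ht.1, le_rfl⟩ hcont
  have hmax : ∀ y, ∀ s ∈ Icc 0 t, sumRadii (fun y => X y s) (fun y => ν y s) y ≤
      sumRadii (fun y => X y q.2) (fun y => ν y q.2) q.1 := fun y s hs => by
    have := isMaxOn_iff.1 hqmax (y, s) (mk_mem_prod (mem_univ y) hs)
    exact this
  have hxq := hmax x t ⟨ht.1, le_rfl⟩
  rcases hq.2.1.eq_or_lt with h0 | h0
  · rw [← h0] at hxq
    exact hxq.trans (hm _)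
  · exact (not_isMax_sumRadii hn hα hX ht₁ hconv ⟨h0, hq.2.2.trans_lt ht.2⟩ fun y s hs =>
      hmax y s ⟨hs.1, hs.2.trans hq.2.2⟩).elim

/-- Strict convexity persists at the end of a time interval of strict convexity: there the second
fundamental form is positive semidefinite as a limit, and its determinant cannot vanish because the
radii stay bounded. -/
theorem isStrictlyConvex_of_forall_lt (hn : 1 ≤ n) (hα : 0 < α) (hX : IsSmoothFlow α T X ν)
    {t₁ : ℝ} (ht₁ : t₁ ∈ Ioo 0 T)
    (hconv : ∀ t ∈ Ico 0 t₁, IsStrictlyConvex (fun x => X x t) (fun x => ν x t))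
    {m : ℝ} (hm : ∀ x, sumRadii (fun y => X y 0) (fun y => ν y 0) x ≤ m) :
    IsStrictlyConvex (fun x => X x t₁) (fun x => ν x t₁) := by
  intro x
  have hn0 : (0 : ℝ) < n := by exact_mod_cast hn
  set h : ℝ → Matrix (Fin n) (Fin n) ℝ := fun t => secondForm (fun y => X y t) (fun y => ν y t) x
  set g : ℝ → Matrix (Fin n) (Fin n) ℝ := fun t => metric (fun y => X y t) x
  set φ := extChartAt 𝓘(ℝ, EuclideanSpace ℝ (Fin n)) x with hφ
  have hxt : φ x ∈ φ.target := mem_extChartAt_target x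
  have hc : φ.symm (φ x) = x := φ.left_inv (mem_extChartAt_source x)
  have ht₁' : t₁ ∈ Ico 0 T := ⟨ht₁.1.le, ht₁.2⟩
  have hlim : Tendsto (fun t : ℝ => (φ x, t)) (𝓝[<] t₁) (𝓝[φ.target ×ˢ Ico 0 T] (φ x, t₁)) := by
    refine tendsto_nhdsWithin_iff.2 ⟨?_, ?_⟩
    · exact ((show Continuous fun t : ℝ => (φ x, t) by fun_prop).tendsto t₁).mono_left
        nhdsWithin_le_nhds
    · filter_upwards [nhdsWithin_le_nhds (Ioo_mem_nhds ht₁.1 ht₁.2)] with t ht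
      exact ⟨hxt, ht.1.le, ht.2⟩
  have hN : ∀ t, spaceTimeParam ν x (φ x, t) = ν x t := fun t => by
    simp only [spaceTimeParam, ← hφ, hc]
  have hheq : ∀ t, paramSecondForm (fun p => spaceTimeParam X x (p, t)) (φ x)
      (spaceTimeParam ν x (φ x, t)) = h t := fun t => by
    rw [hN]
    rfl
  have hgeq : ∀ t, paramMetric (fun p => spaceTimeParam X x (p, t)) (φ x) = g t := fun t => rfl
  have hh : Tendsto h (𝓝[<] t₁) (𝓝 (h t₁)) := by
    have := (continuousOn_secondForm_flow hX x (φ x, t₁) ⟨hxt, ht₁'⟩).tendsto.comp hlim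
    simp only [Function.comp_def, hheq] at this
    exact this
  have hgl : Tendsto g (𝓝[<] t₁) (𝓝 (g t₁)) := by
    have := (continuousOn_metric_flow hX x (φ x, t₁) ⟨hxt, ht₁'⟩).tendsto.comp hlim
    simp only [Function.comp_def, hgeq] at this
    exact this
  have hmem : ∀ᶠ t in 𝓝[<] t₁, t ∈ Ico 0 t₁ := by
    filter_upwards [nhdsWithin_le_nhds (lt_mem_nhds ht₁.1), self_mem_nhdsWithin] with t h1 h2
    exact ⟨h1.le, h2⟩
  have hT : ∀ t ∈ Ico 0 t₁, t ∈ Ico 0 T := fun t ht => ⟨ht.1, ht.2.trans ht₁.2⟩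
  have hherm : (h t₁).IsHermitian := by
    have := isHermitian_paramSecondForm_flow hX (z := (φ x, t₁)) (c := x) ⟨hxt, ht₁'⟩
    simp only [hheq] at this
    exact this
  have hpsd : (h t₁).PosSemidef := by
    refine Matrix.PosSemidef.of_dotProduct_mulVec_nonneg hherm fun v => ?_
    have hq : Continuous fun A : Matrix (Fin n) (Fin n) ℝ => star v ⬝ᵥ A.mulVec v :=
      continuous_const.dotProduct (continuous_id.matrix_mulVec continuous_const)
    refine ge_of_tendsto ((hq.tendsto _).comp hh) ?_
    filter_upwards [hmem] with t ht
    exact (hconv t ht x).posSemidef.dotProduct_mulVec_nonneg v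
  refine hpsd.posDef_iff_det_ne_zero.2 fun hdet0 => ?_
  have hgpos : 0 < (g t₁).det := by
    have hgeo := geometry_in_chart (c := x) (contMDiff_slice hX ht₁') (hX.immersion t₁ ht₁')
      (hX.outward_normal t₁ ht₁') (mem_extChartAt_source x)
    exact (posDef_paramMetric hgeo.1).det_pos
  have hbound : ∀ᶠ t in 𝓝[<] t₁, (g t).det ≤ (m / n) ^ n * (h t).det := by
    filter_upwards [hmem] with t ht
    obtain ⟨hgt, hKpos, hK⟩ := card_mul_curvature_rpow_le_sumRadii hn hX (hT t ht) (hconv t ht x)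
    have hle := hK.trans (sumRadii_le_initial hn hα hX ht₁.2.le hconv hm ht x)
    rw [mul_comm, ← le_div_iff₀ hn0] at hle
    have hpow := pow_le_pow_left₀ (Real.rpow_nonneg hKpos.le _) hle n
    rw [← Real.rpow_natCast, ← Real.rpow_mul hKpos.le, neg_mul, one_div_mul_cancel hn0.ne',
      Real.rpow_neg_one] at hpow
    have hKeq : gaussCurvature (fun y => X y t) (fun y => ν y t) x = (g t).det⁻¹ * (h t).det := by
      rw [gaussCurvature, weingarten, Matrix.det_mul, Matrix.det_nonsing_inv,
        Ring.inverse_eq_inv']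
    have hhpos : 0 < (h t).det := (hconv t ht x).det_pos
    rw [hKeq, mul_inv, inv_inv, ← div_eq_mul_inv, div_le_iff₀ hhpos] at hpow
    exact hpow
  have hdetc : Continuous fun A : Matrix (Fin n) (Fin n) ℝ => A.det := continuous_id.matrix_det
  have := le_of_tendsto_of_tendsto ((hdetc.tendsto _).comp hgl)
    (((hdetc.tendsto _).comp hh).const_mul ((m / n) ^ n)) hbound
  rw [hdet0, mul_zero] at this
  exact this.not_gt hgpos

/-- Strict convexity is preserved by the flow. -/
theorem isStrictlyConvex_of_initial (hn : 1 ≤ n) (hα : 0 < α) (hX : IsSmoothFlow α T X ν)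
    (hconv : IsStrictlyConvex (fun x => X x 0) (fun x => ν x 0))
    {m : ℝ} (hm : ∀ x, sumRadii (fun y => X y 0) (fun y => ν y 0) x ≤ m) {t : ℝ}
    (ht : t ∈ Ico 0 T) : IsStrictlyConvex (fun x => X x t) (fun x => ν x t) := by
  -- otherwise there is a first time at which strict convexity fails
  by_contra hcon
  set Z : Set (M × ℝ) := {q | q ∈ univ ×ˢ Icc 0 t ∧
    ¬(secondForm (fun y => X y q.2) (fun y => ν y q.2) q.1).PosDef} with hZ
  have hsub : (univ : Set M) ×ˢ Icc 0 t ⊆ univ ×ˢ Ico 0 T :=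
    prod_mono le_rfl fun s hs => ⟨hs.1, hs.2.trans_lt ht.2⟩
  have hclosed : IsClosed Z := by
    rw [← isOpen_compl_iff, isOpen_iff_mem_nhds]
    intro q hq
    by_cases hqK : q ∈ (univ : Set M) ×ˢ Icc 0 t
    · have hpd : (secondForm (fun y => X y q.2) (fun y => ν y q.2) q.1).PosDef := by
        by_contra h
        exact hq ⟨hqK, h⟩
      filter_upwards [eventually_nhdsWithin_iff.1
        (eventually_posDef_secondForm hX (c := q.1) (hsub hqK).2 hpd)] with q' hq' hq'Z
      exact hq'Z.2 (hq' (hsub hq'Z.1))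
    · filter_upwards [(isClosed_univ.prod isClosed_Icc).isOpen_compl.mem_nhds hqK] with q' hq' hq'Z
      exact hq' hq'Z.1
  have hcompact : IsCompact Z :=
    (isCompact_univ.prod isCompact_Icc).of_isClosed_subset hclosed fun q hq => hq.1
  have hne : Z.Nonempty := by
    simp only [IsStrictlyConvex, not_forall] at hcon
    obtain ⟨x, hx⟩ := hcon
    exact ⟨(x, t), ⟨mem_univ _, ht.1, le_rfl⟩, hx⟩
  obtain ⟨q, hq, hqmin⟩ := hcompact.exists_isMinOn hne continuousOn_snd
  have hq0 : 0 < q.2 := by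
    refine lt_of_le_of_ne hq.1.2.1 fun h0 => hq.2 ?_
    rw [← h0]
    exact hconv q.1
  refine hq.2 (isStrictlyConvex_of_forall_lt hn hα hX ⟨hq0, (hsub hq.1).2.2⟩ (fun s hs x => ?_)
    hm q.1)
  by_contra hx
  exact (hqmin (show (x, s) ∈ Z from ⟨⟨mem_univ _, hs.1, hs.2.le.trans hq.1.2.2⟩, hx⟩)).not_gt hs.2

end Flow

end GaussCurvatureFlow

open GaussCurvatureFlow in
theorem lemma3p3 {n : ℕ} (hn : 1 ≤ n) {M : Type*} [TopologicalSpace M]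
    [ChartedSpace (EuclideanSpace ℝ (Fin n)) M]
    [IsManifold 𝓘(ℝ, EuclideanSpace ℝ (Fin n)) ∞ M] [CompactSpace M] [ConnectedSpace M]
    (α : ℝ) (hα : 1 / (n : ℝ) < α) (hα' : α ≤ 1) (T : ℝ) (hT : 0 < T)
    (X ν : M → ℝ → EuclideanSpace ℝ (Fin (n + 1))) (hX : IsSmoothFlow α T X ν)
    (hconv : IsStrictlyConvex (fun x => X x 0) (fun x => ν x 0)) :
    ∃ C : ℝ, 0 < C ∧ ∀ t ∈ Ioo 0 T,
      IsStrictlyConvex (fun x => X x t) (fun x => ν x t) ∧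
      BddAbove (range fun x => sumRadii (fun y => X y t) (fun y => ν y t) x) ∧
      (⨆ x, sumRadii (fun y => X y t) (fun y => ν y t) x) ≤
        max
          (⨆ x, ((n : ℝ) * α - 1) / α *
            gaussCurvature (fun y => X y t) (fun y => ν y t) x ^ (-(1 / (n : ℝ))))
          (⨆ x, sumRadii (fun y => X y 0) (fun y => ν y 0) x) ∧
      max
          (⨆ x, ((n : ℝ) * α - 1) / α *
            gaussCurvature (fun y => X y t) (fun y => ν y t) x ^ (-(1 / (n : ℝ))))
          (⨆ x, sumRadii (fun y => X y 0) (fun y => ν y 0) x) ≤ C := by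
  have hn0 : (0 : ℝ) < n := by exact_mod_cast hn
  have hα0 : 0 < α := (one_div_pos.2 hn0).trans hα
  have h0 : (0 : ℝ) ∈ Ico 0 T := ⟨le_rfl, hT⟩
  have hcont : Continuous fun x => sumRadii (fun y => X y 0) (fun y => ν y 0) x := by
    rw [← continuousOn_univ]
    intro x _
    have hin : ContinuousWithinAt (fun x : M => (x, (0 : ℝ))) univ x := by fun_prop
    exact ContinuousWithinAt.comp (f := fun x : M => (x, (0 : ℝ)))
      (continuousWithinAt_sumRadii hX h0 (hconv x)) hin fun y _ => ⟨mem_univ _, h0⟩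
  have hbdd : BddAbove (range fun x => sumRadii (fun y => X y 0) (fun y => ν y 0) x) :=
    (isCompact_range hcont).bddAbove
  set m := ⨆ x, sumRadii (fun y => X y 0) (fun y => ν y 0) x with hm
  have hle : ∀ x, sumRadii (fun y => X y 0) (fun y => ν y 0) x ≤ m := fun x => le_ciSup hbdd x
  have hstrict : ∀ t ∈ Ico 0 T, IsStrictlyConvex (fun x => X x t) (fun x => ν x t) := fun t ht =>
    isStrictlyConvex_of_initial hn hα0 hX hconv hle ht
  have hR : ∀ t ∈ Ico 0 T, ∀ x, sumRadii (fun y => X y t) (fun y => ν y t) x ≤ m := fun t ht x =>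
    sumRadii_le_initial hn hα0 hX le_rfl hstrict hle ht x
  -- the last two summands only serve to make the constant positive
  refine ⟨max (((n : ℝ) * α - 1) / α * (m / n)) m + 1 + |m|, ?_, fun t ht => ?_⟩
  · have := le_max_right (((n : ℝ) * α - 1) / α * (m / n)) m
    have := neg_abs_le m
    linarith
  · have ht' : t ∈ Ico 0 T := ⟨ht.1.le, ht.2⟩
    refine ⟨hstrict t ht', ⟨m, ?_⟩, ?_, ?_⟩
    · rintro _ ⟨x, rfl⟩
      exact hR t ht' x
    · exact le_max_of_le_right (ciSup_le (hR t ht'))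
    · have hcoef : 0 ≤ ((n : ℝ) * α - 1) / α := by
        rw [div_lt_iff₀ hn0] at hα
        exact div_nonneg (by linarith) hα0.le
      have hsup : (⨆ x, ((n : ℝ) * α - 1) / α *
          gaussCurvature (fun y => X y t) (fun y => ν y t) x ^ (-(1 / (n : ℝ)))) ≤
          ((n : ℝ) * α - 1) / α * (m / n) := by
        refine ciSup_le fun x => mul_le_mul_of_nonneg_left ?_ hcoef
        rw [le_div_iff₀ hn0, mul_comm]
        exact (card_mul_curvature_rpow_le_sumRadii hn hX ht' (hstrict t ht' x)).2.2.trans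
          (hR t ht' x)
      have := max_le_max hsup (le_refl m)
      have := abs_nonneg m
      linarith
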